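/- **Theorem (CLT for smoothed U-statistics with nuisances).** Let $\mathcal Z,\mathcal W$ be measurable spaces, let $Z\sim P_Z$ take values in $\mathcal Z$, let $W=w(Z)\in\mathcal W$ be a measurable component of $Z$ with law $P_W$, and let $r\ge 1$, $k\ge 0$. For every $\beta>0$ let $m^\beta(z_1,\dots,z_r;g)\in\mathbb R$ be a score depending on $z_1,\dots,z_r\in\mathcal Z$ and a function $g:\mathcal W\to\mathbb R^k$, symmetric in $z_1,\dots,z_r$ for each $g$, let $g_\beta\in L^2(P_W)$ be its true nuisance, and put $\theta_\beta:=\mathbb E[m^\beta(Z_1,\dots,Z_r;g_\beta)]$ for i.i.d. $Z_1,\dots,Z_r\sim P_Z$. Let $m^*(z_1,\dots,z_r;g)$ be a limiting score and $g_0\in L^2(P_W)$ a limiting nuisance. For each $n$ let $Z_1,\dots,Z_n$ be i.i.d. from $P_Z$, let $\beta_n>0$ with $\beta_n\to\infty$, and let $\hat g_n\in L^2(P_W)$ be a random nuisance estimate independent of $Z_1,\dots,Z_n$, such that $m^{\beta_n}(z_1,\dots,z_r;\hat g_n)$ is jointly measurable in $(z_1,\dots,z_r)$ and the randomness of $\hat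 g_n$ (the functions $m^\beta(\cdot\,;g_\beta)$ and $m^*(\cdot\,;g_0)$ are measurable as well). Write $$\mathbb P_{n,r}f:=\binom nr^{-1}\sum_{\{i_1<\dots<i_r\}\subset\{1,\dots,n\}}f(Z_{i_1},\dots,Z_{i_r}),\qquad \mathbb G_{n,r}f:=\sqrt n\Big(\mathbb P_{n,r}f-\int f\,dP_Z^{\otimes r}\Big),$$ $\hat\theta_n:=\mathbb P_{n,r}\,m^{\beta_n}(\cdot\,;\hat g_n)$ and $M^\beta(g):=\int m^\beta(z;g)\,dP_Z^{\otimes r}(z)$ (so a random $g$ is held fixed in $M^\beta(g)$). The first and second Gateaux derivatives of a functional $T$ at $f$ in direction $h$ are $D T(f)(h):=\frac{d}{dt}T(f+th)|_{t=0}$ and $D^2T(f)(h,h):=\frac{d^2}{dt^2}T(f+th)|_{t=0}$, and $[f,g]:=\{(1-\lambda)f+\lambda g:\lambda\in[0,1]\}$. Suppose: 1. (Neyman orthogonality) For all $\beta>0$ and all $n$, almost surely, $D M^\beta(g_\beta)(\hat g_n-g_\beta)$ exists and equals $0$. 2. (Second-order Gateaux derivatives) For all $n$, almost surely, $D^2M^{\beta_n}(\bar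 g)(\hat g_n-g_{\beta_n},\hat g_n-g_{\beta_n})$ exists for every $\bar g\in[g_{\beta_n},\hat g_n]$; and for every choice of (possibly random) $\bar g_n\in[g_{\beta_n},\hat g_n]$, $$D^2M^{\beta_n}(\bar g_n)(\hat g_n-g_{\beta_n},\hat g_n-g_{\beta_n})=o_{\mathbb P}(n^{-1/2}).$$ Here $\bar g_n$ need not be measurable, and $o_{\mathbb P}$ is then understood with outer probability. 3. (Convergence of score) $m^\beta(Z_1,\dots,Z_r;g_\beta)\to m^*(Z_1,\dots,Z_r;g_0)$ in probability as $\beta\to\infty$. 4. (Stochastic equicontinuity) $\big|\mathbb G_{n,r}m^{\beta_n}(\cdot\,;\hat g_n)-\mathbb G_{n,r}m^{\beta_n}(\cdot\,;g_{\beta_n})\big|=o_{\mathbb P}(1)$. 5. (Regularity) There are $D,\epsilon>0$ with $\|m^\beta(\cdot\,;g_\beta)\|_{L^{2+\epsilon}(P_Z^{\otimes r})}\le D$ for all $\beta>0$ and $\|m^*(\cdot\,;g_0)\|_{L^{2+\epsilon}(P_Z^{\otimes r})}\le D$. Then, with $\theta_0:=\mathbb E[m^*(Z_1,\dots,Z_r;g_0)]$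 and $\rho_\theta(z):=r\{\mathbb E[m^*(Z_1,\dots,Z_r;g_0)\mid Z_1=z]-\theta_0\}$, $$\sqrt n(\hat\theta_n-\theta_{\beta_n})=\frac1{\sqrt n}\sum_{i=1}^n\rho_\theta(Z_i)+o_{\mathbb P}(1).$$ Moreover, if $\Sigma^*:=\mathrm{Var}[\rho_\theta(Z)]>0$, then $\sqrt n(\hat\theta_n-\theta_{\beta_n})\Rightarrow\mathcal N(0,\Sigma^*)$. -/

import Mathlib

open MeasureTheory ProbabilityTheory Filter Topology

namespace SmoothUStat

/-- Nuisance functions `g : 𝒲 → ℝ^k`. -/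
abbrev Nuisance (𝒲 : Type*) (k : ℕ) := 𝒲 → EuclideanSpace ℝ (Fin k)

/-- The law `P^{⊗ r}` of `r` i.i.d. observations. -/
noncomputable abbrev prodLaw {𝒵 : Type*} [MeasurableSpace 𝒵] (P : Measure 𝒵) (r : ℕ) :
    Measure (Fin r → 𝒵) :=
  Measure.pi fun _ => P

/-- `ℙ_{n,r} f`: the average of `f` over all size-`r` subsets of the sample `z_1, …, z_n`
(each subset enumerated in increasing order). -/
noncomputable def uMean {𝒵 : Type*} {n r : ℕ} (f : (Fin r → 𝒵) → ℝ) (z : Fin n → 𝒵) : ℝ :=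
  (n.choose r : ℝ)⁻¹ *
    ∑ s : {s : Finset (Fin n) // s.card = r}, f fun j => z (s.1.orderEmbOfFin s.2 j)

/-- `𝔾_{n,r} f = √n (ℙ_{n,r} f - E f)`, with `E` the expectation under `P^{⊗ r}` only. -/
noncomputable def uFluctuation {𝒵 : Type*} [MeasurableSpace 𝒵] (P : Measure 𝒵) {n r : ℕ}
    (f : (Fin r → 𝒵) → ℝ) (z : Fin n → 𝒵) : ℝ :=
  √(n : ℝ) * (uMean f z - ∫ x, f x ∂prodLaw P r)

/-- The population functional `g ↦ E[m(Z_1, …, Z_r; g)]` of a score `m`. -/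
noncomputable def popMean {𝒵 𝒲 : Type*} [MeasurableSpace 𝒵] {k r : ℕ} (P : Measure 𝒵)
    (m : (Fin r → 𝒵) → Nuisance 𝒲 k → ℝ) (g : Nuisance 𝒲 k) : ℝ :=
  ∫ z, m z g ∂prodLaw P r

/-- `T` has Gateaux derivative `a` at `f` in the direction `h`. -/
def HasGateauxDeriv {B : Type*} [AddCommGroup B] [Module ℝ B] (T : B → ℝ) (f h : B) (a : ℝ) :
    Prop :=
  HasDerivAt (fun t : ℝ => T (f + t • h)) a 0

/-- The second Gateaux derivative of `T` at `f` in the direction `h` exists. -/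
def GateauxTwiceDifferentiable {B : Type*} [AddCommGroup B] [Module ℝ B] (T : B → ℝ) (f h : B) :
    Prop :=
  (∀ᶠ t in 𝓝 (0 : ℝ), DifferentiableAt ℝ (fun t : ℝ => T (f + t • h)) t) ∧
    DifferentiableAt ℝ (deriv fun t : ℝ => T (f + t • h)) 0

/-- The second Gateaux derivative of `T` at `f` in the direction `h`. -/
noncomputable def gateauxDeriv₂ {B : Type*} [AddCommGroup B] [Module ℝ B] (T : B → ℝ) (f h : B) :
    ℝ :=
  deriv (deriv fun t : ℝ => T (f + t • h)) 0

/-- `X_n = o_ℙ(a_n)`, i.e. `X_n / a_n → 0` in probability. -/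
def IsLittleOP {Ω : Type*} [MeasurableSpace Ω] (μ : Measure Ω) (X : ℕ → Ω → ℝ) (a : ℕ → ℝ) :
    Prop :=
  TendstoInMeasure μ (fun n ω => X n ω / a n) atTop fun _ => 0

/-- The regular version of `z ↦ E[f(Z_1, …, Z_r) | Z_1 = z]` for i.i.d. `Z_1, …, Z_r ∼ P`:
the first argument is set to `z` and the others are integrated out. -/
noncomputable def condMeanFirst {𝒵 : Type*} [MeasurableSpace 𝒵] (P : Measure 𝒵) {r : ℕ}
    [NeZero r] (f : (Fin r → 𝒵) → ℝ) (z : 𝒵) : ℝ :=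
  ∫ x, f (Function.update x 0 z) ∂prodLaw P r

/-- Resampling the first coordinate leaves the product law unchanged. -/
theorem measurePreserving_update_first {𝒵 : Type*} [MeasurableSpace 𝒵] (P : Measure 𝒵)
    [IsProbabilityMeasure P] {r : ℕ} [NeZero r] :
    MeasurePreserving (fun p : 𝒵 × (Fin r → 𝒵) => Function.update p.2 0 p.1)
      (P.prod (prodLaw P r)) (prodLaw P r) := by
  have hm : Measurable (fun p : 𝒵 × (Fin r → 𝒵) => Function.update p.2 0 p.1) := by
    refine measurable_pi_lambda _ fun i => ?_
    by_cases h : i = 0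
    · subst h; simpa using measurable_fst
    · simp only [Function.update_of_ne h]
      fun_prop
  refine ⟨hm, (Measure.pi_eq fun s hs => ?_).symm⟩
  rw [Measure.map_apply hm (MeasurableSet.univ_pi hs)]
  have : (fun p : 𝒵 × (Fin r → 𝒵) => Function.update p.2 0 p.1) ⁻¹' (Set.univ.pi s)
      = s 0 ×ˢ Set.univ.pi (Function.update s 0 Set.univ) := by
    ext p
    simp only [Set.mem_preimage, Set.mem_univ_pi, Set.mem_prod]
    constructor
    · intro h
      refine ⟨by simpa using h 0, fun i => ?_⟩
      by_cases hi : i = 0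
      · subst hi; simp
      · simpa [hi] using h i
    · rintro ⟨h0, h⟩ i
      by_cases hi : i = 0
      · subst hi; simpa using h0
      · simpa [hi] using h i
  rw [this, Measure.prod_prod, Measure.pi_pi]
  rw [← Finset.mul_prod_erase Finset.univ _ (Finset.mem_univ (0 : Fin r)),
    ← Finset.mul_prod_erase Finset.univ (fun i => P (s i)) (Finset.mem_univ (0 : Fin r))]
  simp only [Function.update_self, measure_univ, one_mul]
  congr 1
  refine Finset.prod_congr rfl fun i hi => ?_
  rw [Function.update_of_ne (Finset.ne_of_mem_erase hi)]

/-- `condMeanFirst` is a version of the conditional expectation given the first coordinate. -/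
theorem condMeanFirst_ae_eq_condExp {𝒵 : Type*} [mZ : MeasurableSpace 𝒵] (P : Measure 𝒵)
    [IsProbabilityMeasure P] {r : ℕ} [NeZero r] (f : (Fin r → 𝒵) → ℝ) (hf : Measurable f)
    (hfi : Integrable f (prodLaw P r)) :
    (fun x : Fin r → 𝒵 => condMeanFirst P f (x 0)) =ᵐ[prodLaw P r]
      (prodLaw P r)[f | mZ.comap fun x : Fin r → 𝒵 => x 0] := by
  have hmp := measurePreserving_update_first P (r := r)
  have hev : MeasurePreserving (fun x : Fin r → 𝒵 => x 0) (prodLaw P r) P :=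
    measurePreserving_eval (fun _ => P) 0
  have hg : Measurable (fun p : 𝒵 × (Fin r → 𝒵) => f (Function.update p.2 0 p.1)) :=
    hf.comp hmp.measurable
  have hgi : Integrable (fun p : 𝒵 × (Fin r → 𝒵) => f (Function.update p.2 0 p.1))
      (P.prod (prodLaw P r)) := hmp.integrable_comp_of_integrable hfi
  have hsm : StronglyMeasurable (condMeanFirst P f) :=
    hg.stronglyMeasurable.integral_prod_right
  have hci : Integrable (condMeanFirst P f) P := hgi.integral_prod_left
  have hci' : Integrable (fun x : Fin r → 𝒵 => condMeanFirst P f (x 0)) (prodLaw P r) :=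
    hev.integrable_comp_of_integrable hci
  refine ae_eq_condExp_of_forall_setIntegral_eq hev.measurable.comap_le hfi
    (fun s _ _ => hci'.integrableOn) ?_ ?_
  · rintro s ⟨t, ht, rfl⟩ -
    have hpre : MeasurableSet ((fun x : Fin r → 𝒵 => x 0) ⁻¹' t) := hev.measurable ht
    have h1 : ∫ x in (fun x : Fin r → 𝒵 => x 0) ⁻¹' t, condMeanFirst P f (x 0) ∂prodLaw P r
        = ∫ z in t, condMeanFirst P f z ∂P := by
      have h := setIntegral_map (μ := prodLaw P r) (g := fun x : Fin r → 𝒵 => x 0) ht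
        (hsm.aestronglyMeasurable (μ := _)) hev.measurable.aemeasurable
      rw [hev.map_eq] at h
      exact h.symm
    have h2 : ∫ x in (fun x : Fin r → 𝒵 => x 0) ⁻¹' t, f x ∂prodLaw P r
        = ∫ p in t ×ˢ Set.univ, f (Function.update p.2 0 p.1) ∂P.prod (prodLaw P r) := by
      conv_lhs => rw [← hmp.map_eq]
      rw [setIntegral_map hpre hf.aestronglyMeasurable hmp.measurable.aemeasurable]
      congr 2
      ext p
      simp
    rw [h1, h2, setIntegral_prod _ hgi.integrableOn]
    simp [condMeanFirst]
  · exact (hsm.comp_measurable (comap_measurable _)).aestronglyMeasurable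

/-- The influence function `ρ(z) = r {E[f(Z_1, …, Z_r) | Z_1 = z] - E[f(Z_1, …, Z_r)]}`. -/
noncomputable def influence {𝒵 : Type*} [MeasurableSpace 𝒵] (P : Measure 𝒵) {r : ℕ} [NeZero r]
    (f : (Fin r → 𝒵) → ℝ) (z : 𝒵) : ℝ :=
  (r : ℝ) * (condMeanFirst P f z - ∫ x, f x ∂prodLaw P r)

end SmoothUStat

/-! Write `M` for the population mean of the score at `β n`. The centred and scaled estimator splits
exactly into three terms: the difference of the U-statistic fluctuations at `ĝ` and at the true
nuisance, the bias `√n (M(ĝ) - M(g_β))`, and the fluctuation at the true nuisance. The first is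
negligible by equicontinuity. For the bias, expand `M` along the segment from `g_β` to `ĝ`:
orthogonality kills the first-order term, leaving half a second derivative at an intermediate point,
which is `o(n^{-1/2})` (`exists_segment_sub_eq_half_gauxteauxDeriv₂` is not needed beyond this).

The third term is a U-statistic whose kernel changes with `n`. Subtracting the mean and the
projection onto single observations leaves a kernel that is degenerate in each coordinate. Two
subsets meeting in at most one index then give orthogonal terms, and subsets meeting in two or more
are so rare that the remainder has second moment `O(n⁻²)` (`integral_uMean_sq_le`), hence vanishes
after scaling by `√n`. The linear part depends Lipschitz continuously on the kernel in `L²`.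
Convergence in probability and the `L^{2+ε}` bound give `L²` convergence of the kernels, so the
influence function may be replaced by that of the limit
(`tendstoInMeasure_uFluctuation_sub_linear`). The classical CLT and Slutsky's lemma finish. -/

namespace SmoothUStat

/-! ### Counting subsets through one or two given points. -/

/-- The number of size-`r` subsets of `Fin n` containing a given set. -/
theorem sum_indicator_superset {n r : ℕ} (A : Finset (Fin n)) (hA : A.card ≤ r) :
    ∑ s : {s : Finset (Fin n) // s.card = r}, (if A ⊆ s.1 then (1 : ℝ) else 0)
      = (n - A.card).choose (r - A.card) := by
  have h := Finset.card_filter_powersetCard_subset A Finset.univ r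
  simp only [Finset.subset_univ, hA, Finset.card_univ, Fintype.card_fin, forall_const] at h
  have e : (Finset.univ.powersetCard r).filter (A ⊆ ·)
      = (Finset.univ.filter fun s : {s : Finset (Fin n) // s.card = r} => A ⊆ s.1).map
        (Function.Embedding.subtype _) := by
    ext s
    simp [and_comm]
  rw [Finset.sum_boole, ← Finset.card_map (Function.Embedding.subtype _), ← e]
  exact_mod_cast h

theorem sum_indicator_singleton {n r : ℕ} (hr : 1 ≤ r) (i : Fin n) :
    (∑ s : {s : Finset (Fin n) // s.card = r}, (if i ∈ s.1 then (1 : ℝ) else 0)) * n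
      = r * n.choose r := by
  have h := sum_indicator_superset (r := r) {i} (by simpa using hr)
  simp only [Finset.singleton_subset_iff, Finset.card_singleton] at h
  rw [h]
  obtain ⟨r, rfl⟩ := Nat.exists_eq_add_of_le' hr
  obtain ⟨n, rfl⟩ := Nat.exists_eq_add_of_le' (show 1 ≤ n from Fin.pos i)
  have := Nat.add_one_mul_choose_eq n r
  simp only [Nat.add_sub_cancel]
  have h2 : (((n + 1) * n.choose r : ℕ) : ℝ) = (((n + 1).choose (r + 1) * (r + 1) : ℕ) : ℝ) := by
    rw [this]
  push_cast at h2 ⊢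
  linarith

/-- A random `r`-subset contains a given pair with probability `r(r-1)/(n(n-1))`. Cleared of
denominators, this remains true for `r > n`, where both sides vanish. -/
theorem sum_indicator_pair {n r : ℕ} (hr : 1 ≤ r) (i j : Fin n) (hij : i ≠ j) :
    (∑ s : {s : Finset (Fin n) // s.card = r}, (if i ∈ s.1 ∧ j ∈ s.1 then (1 : ℝ) else 0))
        * (n * (n - 1)) = r * (r - 1) * n.choose r := by
  rcases hr.eq_or_lt with rfl | hr
  · have : ∀ s : {s : Finset (Fin n) // s.card = 1}, ¬ (i ∈ s.1 ∧ j ∈ s.1) := by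
      rintro ⟨s, hs⟩ ⟨h1, h2⟩
      exact hij (Finset.card_le_one.1 hs.le _ h1 _ h2)
    simp [this]
  have h := sum_indicator_superset (r := r) {i, j} (by rw [Finset.card_pair hij]; exact hr)
  simp only [Finset.insert_subset_iff, Finset.singleton_subset_iff, Finset.card_pair hij] at h
  rw [h]
  have hn : 2 ≤ n := by
    have := Finset.card_le_univ ({i, j} : Finset (Fin n))
    simpa [Finset.card_pair hij] using this
  obtain ⟨r, rfl⟩ := Nat.exists_eq_add_of_le' (show 2 ≤ r from hr)
  obtain ⟨n, rfl⟩ := Nat.exists_eq_add_of_le' hn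
  have h1 := congrArg (Nat.cast (R := ℝ)) (Nat.add_one_mul_choose_eq n r)
  have h2 := congrArg (Nat.cast (R := ℝ)) (Nat.add_one_mul_choose_eq (n + 1) (r + 1))
  push_cast at h1 h2 ⊢
  simp only [add_assoc, one_add_one_eq_two] at h1 h2 ⊢
  linear_combination (n + 2 : ℝ) * h1 + (r + 1 : ℝ) * h2

theorem _root_.MeasureTheory.MeasurePreserving.integral_comp_of_aestronglyMeasurable
    {α β : Type*} [MeasurableSpace α] [MeasurableSpace β] {μ : Measure α} {ν : Measure β}
    {T : α → β} (hT : MeasurePreserving T μ ν) {f : β → ℝ} (hf : AEStronglyMeasurable f ν) :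
    ∫ a, f (T a) ∂μ = ∫ b, f b ∂ν := by
  rw [← hT.map_eq] at hf ⊢
  exact (integral_map hT.measurable.aemeasurable hf).symm

/-! ### Invariance of product laws and orthogonality of degenerate kernels. -/

section Resampling

variable {𝒵 ι κ : Type*} [MeasurableSpace 𝒵] [Fintype ι] [Fintype κ]

/-- Selecting distinct coordinates of an i.i.d. sample gives an i.i.d. sample. -/
theorem measurePreserving_comp_embedding (P : Measure 𝒵) [IsProbabilityMeasure P] (e : ι ↪ κ) :
    MeasurePreserving (fun z : κ → 𝒵 => z ∘ e) (Measure.pi fun _ => P) (Measure.pi fun _ => P) := by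
  refine ⟨by fun_prop, ?_⟩
  have h : iIndepFun (fun (i : κ) (z : κ → 𝒵) => z i) (Measure.pi fun _ => P) :=
    iIndepFun_pi (X := fun _ => id) fun _ => aemeasurable_id
  have h2 := (iIndepFun_iff_map_fun_eq_pi_map (fun i => (measurable_pi_apply _).aemeasurable)).1
    (h.precomp e.injective)
  have h3 : ∀ i, (Measure.pi fun _ : κ => P).map (fun z => z (e i)) = P :=
    fun i => (measurePreserving_eval (fun _ => P) (e i)).map_eq
  simp only [h3] at h2
  exact h2

/-- Replacing a block of coordinates by an independent copy leaves the product law unchanged. -/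
theorem measurePreserving_piecewise [DecidableEq κ] (P : Measure 𝒵) [IsProbabilityMeasure P]
    (B : Finset κ) :
    MeasurePreserving (fun p : (κ → 𝒵) × (κ → 𝒵) => B.piecewise p.2 p.1)
      ((Measure.pi fun _ => P).prod (Measure.pi fun _ => P)) (Measure.pi fun _ => P) := by
  have hm : Measurable (fun p : (κ → 𝒵) × (κ → 𝒵) => B.piecewise p.2 p.1) := by
    refine measurable_pi_lambda _ fun i => ?_
    by_cases h : i ∈ B
    · simp only [h, Finset.piecewise_eq_of_mem]; fun_prop
    · simp only [h, not_false_eq_true, Finset.piecewise_eq_of_notMem]; fun_prop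
  refine ⟨hm, (Measure.pi_eq fun s hs => ?_).symm⟩
  rw [Measure.map_apply hm (MeasurableSet.univ_pi hs)]
  have : (fun p : (κ → 𝒵) × (κ → 𝒵) => B.piecewise p.2 p.1) ⁻¹' (Set.univ.pi s)
      = Set.univ.pi (B.piecewise (fun _ => Set.univ) s)
        ×ˢ Set.univ.pi (B.piecewise s (fun _ => Set.univ)) := by
    ext p
    simp only [Set.mem_preimage, Set.mem_univ_pi, Set.mem_prod, ← forall_and]
    refine forall_congr' fun i => ?_
    by_cases h : i ∈ B <;> simp [h]
  rw [this, Measure.prod_prod, Measure.pi_pi, Measure.pi_pi, ← Finset.prod_mul_distrib]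
  refine Finset.prod_congr rfl fun i _ => ?_
  by_cases h : i ∈ B <;> simp [h]

/-- If all but one of the coordinates read by `e` are not read by `e'`, and `h` is degenerate in
the remaining coordinate, then `h (z ∘ e)` and `h' (z ∘ e')` are orthogonal. -/
theorem integral_mul_eq_zero_of_degenerate [DecidableEq ι] (P : Measure 𝒵) [IsProbabilityMeasure P]
    {h h' : (ι → 𝒵) → ℝ}
    (hi : MemLp h 2 (Measure.pi fun _ => P)) (hi' : MemLp h' 2 (Measure.pi fun _ => P))
    (hm : Measurable h)
    (e e' : ι ↪ κ) (j : ι) (hj : ∀ l, l ≠ j → ∀ l', e l ≠ e' l')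
    (hdeg : ∀ᵐ z ∂P, ∫ x, h (Function.update x j z) ∂(Measure.pi fun _ => P) = 0) :
    ∫ z : κ → 𝒵, h (z ∘ e) * h' (z ∘ e') ∂(Measure.pi fun _ => P) = 0 := by
  classical
  -- `B` holds the positions read by `e` other than `e j`. Resampling them does not affect `h'`,
  -- while `h` sees fresh observations everywhere except in coordinate `j`; integrating over the
  -- fresh copy gives zero by degeneracy.
  set B : Finset κ := (Finset.univ.erase j).map e with hB
  have hmp := measurePreserving_piecewise P B
  have he := measurePreserving_comp_embedding P e
  have he' := measurePreserving_comp_embedding P e'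
  have hF : Integrable (fun z : κ → 𝒵 => h (z ∘ e) * h' (z ∘ e')) (Measure.pi fun _ => P) :=
    (hi.comp_measurePreserving he).integrable_mul (hi'.comp_measurePreserving he')
  have hF2 := hmp.integrable_comp_of_integrable hF
  rw [← hmp.integral_comp_of_aestronglyMeasurable hF.aestronglyMeasurable]
  refine (integral_prod _ hF2).trans ?_
  have h1 : ∀ y z : κ → 𝒵, (B.piecewise y z) ∘ e = Function.update (y ∘ e) j (z (e j)) := by
    intro y z
    ext l
    by_cases hl : l = j
    · subst hl; simp [hB]
    · simp [hB, hl]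
  have h2 : ∀ y z : κ → 𝒵, (B.piecewise y z) ∘ e' = z ∘ e' := by
    intro y z
    ext l
    have : e' l ∉ B := by
      simp only [hB, Finset.mem_map, Finset.mem_erase, Finset.mem_univ, and_true, not_exists,
        not_and]
      exact fun a ha hh => hj a ha l hh
    simp [this]
  have h3 := (measurePreserving_eval (fun _ : κ => P) (e j)).quasiMeasurePreserving.ae hdeg
  refine integral_eq_zero_of_ae ?_
  filter_upwards [h3] with z hz
  simp only [Function.comp_def (fun z : κ → 𝒵 => h (z ∘ e) * h' (z ∘ e')), h1, h2, Pi.zero_apply]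
  rw [integral_mul_const]
  have h4 : ∫ y : κ → 𝒵, h (Function.update (y ∘ e) j (z (e j))) ∂(Measure.pi fun _ => P)
      = ∫ x, h (Function.update x j (z (e j))) ∂(Measure.pi fun _ => P) := by
    have hm2 : Measurable fun x : ι → 𝒵 => h (Function.update x j (z (e j))) :=
      hm.comp measurable_update_left
    exact he.integral_comp_of_aestronglyMeasurable hm2.aestronglyMeasurable
  rw [h4]
  simp only [Function.eval] at hz
  rw [hz, zero_mul]

end Resampling

/-! ### Second moment of a degenerate U-statistic. -/

section SecondMoment

variable {𝒵 : Type*} [MeasurableSpace 𝒵]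

/-- The sum over ordered pairs dominates the indicator that `s` and `t` share two points. Each
summand factors into a part in `s` and a part in `t`, so the later double sum over subsets reduces
to pair counts. -/
theorem integral_mul_uKernel_le (P : Measure 𝒵) [IsProbabilityMeasure P] {n r : ℕ} [NeZero r]
    {h : (Fin r → 𝒵) → ℝ} (hm : Measurable h) (hi : MemLp h 2 (prodLaw P r))
    (hdeg : ∀ j, ∀ᵐ z ∂P, ∫ x, h (Function.update x j z) ∂prodLaw P r = 0)
    (s t : {s : Finset (Fin n) // s.card = r}) :
    ∫ z, h (fun j => z (s.1.orderEmbOfFin s.2 j)) * h (fun j => z (t.1.orderEmbOfFin t.2 j))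
        ∂prodLaw P n
      ≤ (∑ p ∈ (Finset.univ : Finset (Fin n)).offDiag,
          (if p.1 ∈ s.1 ∧ p.2 ∈ s.1 then (1 : ℝ) else 0)
            * (if p.1 ∈ t.1 ∧ p.2 ∈ t.1 then (1 : ℝ) else 0)) * ∫ x, h x ^ 2 ∂prodLaw P r := by
  have hnn : 0 ≤ ∫ x, h x ^ 2 ∂prodLaw P r := integral_nonneg fun _ => sq_nonneg _
  have hterm : ∀ p ∈ (Finset.univ : Finset (Fin n)).offDiag,
      (0 : ℝ) ≤ (if p.1 ∈ s.1 ∧ p.2 ∈ s.1 then (1 : ℝ) else 0)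
            * (if p.1 ∈ t.1 ∧ p.2 ∈ t.1 then (1 : ℝ) else 0) := by
    intro p _
    positivity
  set es := (s.1.orderEmbOfFin s.2).toEmbedding
  set et := (t.1.orderEmbOfFin t.2).toEmbedding
  have ps := measurePreserving_comp_embedding P es
  have pt := measurePreserving_comp_embedding P et
  by_cases hc : ∃ a b, a ≠ b ∧ a ∈ s.1 ∧ b ∈ s.1 ∧ a ∈ t.1 ∧ b ∈ t.1
  · obtain ⟨a, b, hab, h1, h2, h3, h4⟩ := hc
    have hsum := Finset.single_le_sum hterm
      (Finset.mem_offDiag.2 ⟨Finset.mem_univ a, Finset.mem_univ b, hab⟩ : (a, b) ∈ _)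
    simp only [h1, h2, h3, h4, and_self, if_true, one_mul] at hsum
    refine le_trans ?_ (le_mul_of_one_le_left hnn hsum)
    -- With two common points the bound is `ab ≤ a²/2 + b²/2`; both squares have the same integral
    -- because each subset reads `r` i.i.d. observations.
    have is := (hi.comp_measurePreserving ps).integrable_sq
    have it := (hi.comp_measurePreserving pt).integrable_sq
    have e1 : ∫ z, (h ∘ fun z : Fin n → 𝒵 => z ∘ es) z ^ 2 ∂prodLaw P n
        = ∫ x, h x ^ 2 ∂prodLaw P r :=
      ps.integral_comp_of_aestronglyMeasurable (hm.pow_const 2).aestronglyMeasurable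
    have e2 : ∫ z, (h ∘ fun z : Fin n → 𝒵 => z ∘ et) z ^ 2 ∂prodLaw P n
        = ∫ x, h x ^ 2 ∂prodLaw P r :=
      pt.integral_comp_of_aestronglyMeasurable (hm.pow_const 2).aestronglyMeasurable
    have : ∫ z, ((h ∘ fun z : Fin n → 𝒵 => z ∘ es) z ^ 2 / 2
        + (h ∘ fun z : Fin n → 𝒵 => z ∘ et) z ^ 2 / 2) ∂prodLaw P n
        = ∫ x, h x ^ 2 ∂prodLaw P r := by
      rw [integral_add (is.div_const 2) (it.div_const 2), integral_div, integral_div, e1, e2]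
      ring
    rw [← this]
    refine integral_mono ((hi.comp_measurePreserving ps).integrable_mul
      (hi.comp_measurePreserving pt)) ((is.div_const 2).add (it.div_const 2)) fun z => ?_
    have := two_mul_le_add_sq (h fun j => z (s.1.orderEmbOfFin s.2 j))
      (h fun j => z (t.1.orderEmbOfFin t.2 j))
    change h (fun j => z (s.1.orderEmbOfFin s.2 j)) * h (fun j => z (t.1.orderEmbOfFin t.2 j))
      ≤ h (fun j => z (s.1.orderEmbOfFin s.2 j)) ^ 2 / 2
        + h (fun j => z (t.1.orderEmbOfFin t.2 j)) ^ 2 / 2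
    linarith
  · push Not at hc
    refine le_of_eq_of_le ?_ (mul_nonneg (Finset.sum_nonneg hterm) hnn)
    have hms : ∀ l, es l ∈ s.1 := fun l => Finset.orderEmbOfFin_mem _ s.2 l
    have hmt : ∀ l, et l ∈ t.1 := fun l => Finset.orderEmbOfFin_mem _ t.2 l
    -- At most one index is shared: `j` is its position in `s`, or arbitrary if the subsets are
    -- disjoint.
    obtain ⟨j, hj⟩ : ∃ j, ∀ l, l ≠ j → es l ∉ t.1 := by
      by_cases hx : ∃ j, es j ∈ t.1
      · obtain ⟨j, hj⟩ := hx
        exact ⟨j, fun l hl hlt => hc (es l) (es j) (fun h => hl (es.injective h)) (hms l) (hms j)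
          hlt hj⟩
      · push Not at hx
        exact ⟨0, fun l _ => hx l⟩
    exact integral_mul_eq_zero_of_degenerate P hi hi hm es et j
      (fun l hl l' he => hj l hl (he ▸ hmt l')) (hdeg j)

theorem memLp_uMean (P : Measure 𝒵) [IsProbabilityMeasure P] {n r : ℕ}
    {h : (Fin r → 𝒵) → ℝ} (hi : MemLp h 2 (prodLaw P r)) :
    MemLp (fun z : Fin n → 𝒵 => uMean h z) 2 (prodLaw P n) := by
  have h1 := memLp_finsetSum (f := fun (s : {s : Finset (Fin n) // s.card = r}) (z : Fin n → 𝒵) =>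
    h fun j => z (s.1.orderEmbOfFin s.2 j)) Finset.univ fun s _ =>
      hi.comp_measurePreserving (measurePreserving_comp_embedding P
        (s.1.orderEmbOfFin s.2).toEmbedding)
  exact h1.const_mul _

/-- A degenerate U-statistic of order `r` has second moment `O(n⁻²)`. -/
theorem integral_uMean_sq_le (P : Measure 𝒵) [IsProbabilityMeasure P] {n r : ℕ} [NeZero r]
    (hn : 2 ≤ n)
    {h : (Fin r → 𝒵) → ℝ} (hm : Measurable h) (hi : MemLp h 2 (prodLaw P r))
    (hdeg : ∀ j, ∀ᵐ z ∂P, ∫ x, h (Function.update x j z) ∂prodLaw P r = 0) :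
    ∫ z : Fin n → 𝒵, uMean h z ^ 2 ∂prodLaw P n
      ≤ (r * (r - 1)) ^ 2 / (n * (n - 1)) * ∫ x, h x ^ 2 ∂prodLaw P r := by
  set I := ∫ x, h x ^ 2 ∂prodLaw P r
  have hnn : 0 ≤ I := integral_nonneg fun _ => sq_nonneg _
  have hn' : (2 : ℝ) ≤ n := by exact_mod_cast hn
  have hpos : (0 : ℝ) < n * (n - 1) := by nlinarith
  have hr : 1 ≤ r := NeZero.one_le
  have hk : ∀ s : {s : Finset (Fin n) // s.card = r},
      MemLp (fun z : Fin n → 𝒵 => h fun j => z (s.1.orderEmbOfFin s.2 j)) 2 (prodLaw P n) :=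
    fun s => hi.comp_measurePreserving (measurePreserving_comp_embedding P
      (s.1.orderEmbOfFin s.2).toEmbedding)
  have e1 : ∫ z : Fin n → 𝒵, uMean h z ^ 2 ∂prodLaw P n = ((n.choose r : ℝ)⁻¹) ^ 2
      * ∑ s : {s : Finset (Fin n) // s.card = r}, ∑ t : {s : Finset (Fin n) // s.card = r},
        ∫ z, h (fun j => z (s.1.orderEmbOfFin s.2 j)) * h (fun j => z (t.1.orderEmbOfFin t.2 j))
        ∂prodLaw P n := by
    simp only [uMean, mul_pow]
    rw [integral_const_mul]
    congr 1
    simp only [sq, Finset.sum_mul_sum]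
    refine (integral_finsetSum _ fun s _ => integrable_finsetSum _ fun t _ =>
      (hk s).integrable_mul (hk t)).trans (Finset.sum_congr rfl fun s _ => ?_)
    exact integral_finsetSum _ fun t _ => (hk s).integrable_mul (hk t)
  have e2 : ∑ s : {s : Finset (Fin n) // s.card = r}, ∑ t : {s : Finset (Fin n) // s.card = r},
        ∫ z, h (fun j => z (s.1.orderEmbOfFin s.2 j)) * h (fun j => z (t.1.orderEmbOfFin t.2 j))
        ∂prodLaw P n ≤ (r * (r - 1) * n.choose r) ^ 2 / (n * (n - 1)) * I := by
    refine (Finset.sum_le_sum fun s _ => Finset.sum_le_sum fun t _ =>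
      integral_mul_uKernel_le P hm hi hdeg s t).trans (le_of_eq ?_)
    simp only [← Finset.sum_mul]
    congr 1
    have : ∀ s : {s : Finset (Fin n) // s.card = r},
        ∑ t : {s : Finset (Fin n) // s.card = r}, ∑ p ∈ (Finset.univ : Finset (Fin n)).offDiag,
          (if p.1 ∈ s.1 ∧ p.2 ∈ s.1 then (1 : ℝ) else 0)
            * (if p.1 ∈ t.1 ∧ p.2 ∈ t.1 then (1 : ℝ) else 0)
        = ∑ p ∈ (Finset.univ : Finset (Fin n)).offDiag,
          (if p.1 ∈ s.1 ∧ p.2 ∈ s.1 then (1 : ℝ) else 0)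
            * (r * (r - 1) * n.choose r / (n * (n - 1))) := by
      intro s
      rw [Finset.sum_comm]
      refine Finset.sum_congr rfl fun p hp => ?_
      rw [← Finset.mul_sum]
      congr 1
      rw [eq_div_iff hpos.ne']
      exact sum_indicator_pair hr p.1 p.2 (Finset.mem_offDiag.1 hp).2.2
    simp only [this]
    rw [Finset.sum_comm]
    have : ∀ p ∈ (Finset.univ : Finset (Fin n)).offDiag,
        ∑ s : {s : Finset (Fin n) // s.card = r}, (if p.1 ∈ s.1 ∧ p.2 ∈ s.1 then (1 : ℝ) else 0)
            * (r * (r - 1) * n.choose r / (n * (n - 1)))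
          = (r * (r - 1) * n.choose r / (n * (n - 1))) ^ 2 := by
      intro p hp
      rw [← Finset.sum_mul, sq]
      congr 1
      rw [eq_div_iff hpos.ne']
      exact sum_indicator_pair hr p.1 p.2 (Finset.mem_offDiag.1 hp).2.2
    rw [Finset.sum_congr rfl this, Finset.sum_const, nsmul_eq_mul, Finset.offDiag_card]
    have h1 : ((Finset.card (Finset.univ : Finset (Fin n))
        * Finset.card (Finset.univ : Finset (Fin n))
        - Finset.card (Finset.univ : Finset (Fin n)) : ℕ) : ℝ) = n * (n - 1) := by
      rw [Finset.card_univ, Fintype.card_fin, Nat.cast_sub (Nat.le_mul_self n)]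
      push_cast
      ring
    rw [h1]
    field_simp
  rw [e1]
  refine (mul_le_mul_of_nonneg_left e2 (by positivity)).trans ?_
  rw [← mul_assoc]
  refine mul_le_mul_of_nonneg_right ?_ hnn
  rw [mul_div_assoc']
  refine div_le_div_of_nonneg_right ?_ hpos.le
  rw [mul_pow _ (n.choose r : ℝ)]
  -- For `r > n` the binomial coefficient is zero and so is its inverse, hence no assumption `r ≤ n`
  -- is needed.
  rcases eq_or_ne (n.choose r : ℝ) 0 with h0 | h0
  · rw [h0]; simp; positivity
  · field_simp; rfl

/-- `eLpNorm` at exponent two in terms of the second moment. -/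
theorem eLpNorm_two_eq_ofReal_sqrt {α : Type*} [MeasurableSpace α] {μ : Measure α} {f : α → ℝ}
    (hf : MemLp f 2 μ) : eLpNorm f 2 μ = ENNReal.ofReal (√(∫ x, f x ^ 2 ∂μ)) := by
  rw [hf.eLpNorm_eq_integral_rpow_norm (by simp) (by simp)]
  simp [Real.sqrt_eq_rpow]

theorem eLpNorm_sqrt_mul_uMean_le (P : Measure 𝒵) [IsProbabilityMeasure P] {n r : ℕ} [NeZero r]
    (hn : 2 ≤ n)
    {h : (Fin r → 𝒵) → ℝ} (hm : Measurable h) (hi : MemLp h 2 (prodLaw P r))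
    (hdeg : ∀ j, ∀ᵐ z ∂P, ∫ x, h (Function.update x j z) ∂prodLaw P r = 0) :
    eLpNorm (fun z : Fin n → 𝒵 => √(n : ℝ) * uMean h z) 2 (prodLaw P n)
      ≤ ENNReal.ofReal (r * (r - 1) / √(n - 1)) * eLpNorm h 2 (prodLaw P r) := by
  have hn' : (2 : ℝ) ≤ n := by exact_mod_cast hn
  have hr : (1 : ℝ) ≤ r := by exact_mod_cast (NeZero.one_le : 1 ≤ r)
  have hrr : (0 : ℝ) ≤ r * (r - 1) := by nlinarith
  rw [eLpNorm_two_eq_ofReal_sqrt hi, eLpNorm_two_eq_ofReal_sqrt ((memLp_uMean P hi).const_mul _),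
    ← ENNReal.ofReal_mul (by positivity)]
  refine ENNReal.ofReal_le_ofReal ?_
  have h1 := integral_uMean_sq_le P hn hm hi hdeg
  simp only [mul_pow, Real.sq_sqrt (Nat.cast_nonneg n)]
  rw [integral_const_mul]
  refine Real.sqrt_le_iff.2 ⟨by positivity, ?_⟩
  rw [mul_pow, div_pow, Real.sq_sqrt (by linarith),
    Real.sq_sqrt (integral_nonneg fun _ => sq_nonneg _)]
  refine (mul_le_mul_of_nonneg_left h1 (by positivity)).trans (le_of_eq ?_)
  have : (n : ℝ) - 1 ≠ 0 := by linarith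
  field_simp

end SecondMoment

/-! ### Algebra of U-statistics and of symmetric kernels. -/

section Algebra

variable {𝒵 : Type*} {n r : ℕ}

theorem uMean_add (f g : (Fin r → 𝒵) → ℝ) (z : Fin n → 𝒵) :
    uMean (fun x => f x + g x) z = uMean f z + uMean g z := by
  simp only [uMean, Finset.sum_add_distrib, mul_add]

theorem uMean_const (hrn : r ≤ n) (c : ℝ) (z : Fin n → 𝒵) :
    uMean (fun _ : Fin r → 𝒵 => c) z = c := by
  have : (n.choose r : ℝ) ≠ 0 := by exact_mod_cast (Nat.choose_pos hrn).ne'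
  simp only [uMean, Finset.sum_const, Finset.card_univ, Fintype.card_finset_len, Fintype.card_fin,
    nsmul_eq_mul]
  field_simp

/-- The U-statistic of an additive kernel is a sample mean. -/
theorem uMean_sum_apply [NeZero r] (hrn : r ≤ n) (φ : 𝒵 → ℝ) (z : Fin n → 𝒵) :
    uMean (fun x : Fin r → 𝒵 => ∑ j, φ (x j)) z = (n : ℝ)⁻¹ * ∑ i, r * φ (z i) := by
  have hr : 1 ≤ r := NeZero.one_le
  have hc : (n.choose r : ℝ) ≠ 0 := by exact_mod_cast (Nat.choose_pos hrn).ne'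
  have hn : (n : ℝ) ≠ 0 := by exact_mod_cast (by omega : n ≠ 0)
  -- Indicators turn the sum along `s` into a sum over all `i`, so the two sums can be exchanged and
  -- each `i` weighted by the number of subsets containing it.
  have h1 : ∀ s : {s : Finset (Fin n) // s.card = r},
      ∑ j, φ (z (s.1.orderEmbOfFin s.2 j)) = ∑ i, (if i ∈ s.1 then 1 else 0) * φ (z i) := by
    intro s
    have := Finset.sum_map Finset.univ (s.1.orderEmbOfFin s.2).toEmbedding fun i => φ (z i)
    rw [Finset.map_orderEmbOfFin_univ] at this
    simp only [ite_mul, one_mul, zero_mul, Finset.sum_ite_mem, Finset.univ_inter]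
    exact this.symm
  simp only [uMean, h1]
  rw [Finset.sum_comm, Finset.mul_sum, Finset.mul_sum]
  refine Finset.sum_congr rfl fun i _ => ?_
  rw [← Finset.sum_mul, ← mul_assoc, ← mul_assoc]
  congr 1
  have := sum_indicator_singleton hr i
  field_simp
  linarith

/-- For a symmetric function the coordinate which is held fixed does not matter. -/
theorem update_eq_update_first_of_symm [NeZero r] {f : (Fin r → 𝒵) → ℝ}
    (hs : ∀ (σ : Equiv.Perm (Fin r)) x, f (x ∘ σ) = f x) (j : Fin r) (x : Fin r → 𝒵) (z : 𝒵) :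
    f (Function.update x j z) = f (Function.update (x ∘ Equiv.swap 0 j) 0 z) := by
  rw [← hs (Equiv.swap 0 j) (Function.update x j z)]
  congr 1
  ext l
  by_cases hl : l = 0
  · subst hl; simp
  · have : Equiv.swap 0 j l ≠ j := by
      intro h
      exact hl ((Equiv.swap 0 j).injective (h.trans (Equiv.swap_apply_left 0 j).symm))
    simp [hl, this]

end Algebra

/-- On a probability space the absolute mean is at most the `L¹` norm, which is at most the `L²`
norm. -/
theorem eLpNorm_integral_le {α β : Type*} [MeasurableSpace α] [MeasurableSpace β] (ν : Measure α)
    [IsProbabilityMeasure ν] {κ : Measure β} [IsProbabilityMeasure κ] {f : β → ℝ}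
    (hi : MemLp f 2 κ) : eLpNorm (fun _ : α => ∫ x, f x ∂κ) 2 ν ≤ eLpNorm f 2 κ := by
  rw [eLpNorm_const _ (by simp) (IsProbabilityMeasure.ne_zero ν)]
  simp only [measure_univ, ENNReal.one_rpow, mul_one]
  refine (enorm_integral_le_lintegral_enorm f).trans ?_
  rw [← eLpNorm_one_eq_lintegral_enorm]
  exact eLpNorm_le_eLpNorm_of_exponent_le one_le_two hi.1

/-! ### The first-order Hoeffding projection and its `L²` bounds. -/

section Projection

variable {𝒵 : Type*} [MeasurableSpace 𝒵] {r : ℕ} [NeZero r]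

theorem measurable_condMeanFirst (P : Measure 𝒵) [IsProbabilityMeasure P]
    {f : (Fin r → 𝒵) → ℝ} (hf : Measurable f) : Measurable (condMeanFirst P f) := by
  have hg : Measurable (fun p : 𝒵 × (Fin r → 𝒵) => f (Function.update p.2 0 p.1)) :=
    hf.comp (measurePreserving_update_first P).measurable
  exact (hg.stronglyMeasurable.integral_prod_right (ν := prodLaw P r)).measurable

theorem integral_condMeanFirst (P : Measure 𝒵) [IsProbabilityMeasure P]
    {f : (Fin r → 𝒵) → ℝ} (hi : Integrable f (prodLaw P r)) :
    ∫ z, condMeanFirst P f z ∂P = ∫ x, f x ∂prodLaw P r := by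
  have hmp := measurePreserving_update_first P (r := r)
  rw [← hmp.integral_comp_of_aestronglyMeasurable hi.aestronglyMeasurable]
  exact (integral_prod _ (hmp.integrable_comp_of_integrable hi)).symm

/-- Averaging out all but one coordinate contracts the `L²` norm. -/
theorem eLpNorm_condMeanFirst_le (P : Measure 𝒵) [IsProbabilityMeasure P]
    {f : (Fin r → 𝒵) → ℝ} (hf : Measurable f) (hi : Integrable f (prodLaw P r)) :
    eLpNorm (condMeanFirst P f) 2 P ≤ eLpNorm f 2 (prodLaw P r) := by
  have hev : MeasurePreserving (fun x : Fin r → 𝒵 => x 0) (prodLaw P r) P :=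
    measurePreserving_eval (fun _ => P) 0
  rw [← eLpNorm_comp_measurePreserving (measurable_condMeanFirst P hf).aestronglyMeasurable hev]
  exact (eLpNorm_congr_ae (condMeanFirst_ae_eq_condExp P f hf hi)).trans_le
    (eLpNorm_condExp_le_eLpNorm f one_le_two)

theorem memLp_condMeanFirst (P : Measure 𝒵) [IsProbabilityMeasure P]
    {f : (Fin r → 𝒵) → ℝ} (hf : Measurable f) (hi : MemLp f 2 (prodLaw P r)) :
    MemLp (condMeanFirst P f) 2 P :=
  ⟨(measurable_condMeanFirst P hf).aestronglyMeasurable,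
    (eLpNorm_condMeanFirst_le P hf (hi.integrable one_le_two)).trans_lt hi.2⟩

theorem ae_integrable_update_first (P : Measure 𝒵) [IsProbabilityMeasure P]
    {f : (Fin r → 𝒵) → ℝ} (hi : Integrable f (prodLaw P r)) :
    ∀ᵐ z ∂P, Integrable (fun x => f (Function.update x 0 z)) (prodLaw P r) :=
  ((measurePreserving_update_first P).integrable_comp_of_integrable hi).prod_right_ae

/-- Only almost everywhere: Fubini gives integrable sections for almost all `z`, and linearity of
the integral needs them. -/
theorem condMeanFirst_sub_ae (P : Measure 𝒵) [IsProbabilityMeasure P]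
    {f g : (Fin r → 𝒵) → ℝ} (hi : Integrable f (prodLaw P r)) (hj : Integrable g (prodLaw P r)) :
    condMeanFirst P (f - g) =ᵐ[P] condMeanFirst P f - condMeanFirst P g := by
  filter_upwards [ae_integrable_update_first P hi, ae_integrable_update_first P hj] with z h1 h2
  exact integral_sub h1 h2

theorem memLp_influence (P : Measure 𝒵) [IsProbabilityMeasure P]
    {f : (Fin r → 𝒵) → ℝ} (hf : Measurable f) (hi : MemLp f 2 (prodLaw P r)) :
    MemLp (influence P f) 2 P :=
  ((memLp_condMeanFirst P hf hi).sub (memLp_const _)).const_mul _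

theorem integral_influence (P : Measure 𝒵) [IsProbabilityMeasure P]
    {f : (Fin r → 𝒵) → ℝ} (hf : Measurable f) (hi : MemLp f 2 (prodLaw P r)) :
    ∫ z, influence P f z ∂P = 0 := by
  simp only [influence]
  rw [integral_const_mul, integral_sub ((memLp_condMeanFirst P hf hi).integrable one_le_two)
    (integrable_const _), integral_condMeanFirst P (hi.integrable one_le_two)]
  simp

theorem measurable_influence (P : Measure 𝒵) [IsProbabilityMeasure P]
    {f : (Fin r → 𝒵) → ℝ} (hf : Measurable f) : Measurable (influence P f) :=
  ((measurable_condMeanFirst P hf).sub_const _).const_mul _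

theorem eLpNorm_influence_le (P : Measure 𝒵) [IsProbabilityMeasure P]
    {f : (Fin r → 𝒵) → ℝ} (hf : Measurable f) (hi : MemLp f 2 (prodLaw P r)) :
    eLpNorm (influence P f) 2 P ≤ r * 2 * eLpNorm f 2 (prodLaw P r) := by
  have h : influence P f
      = (r : ℝ) • (condMeanFirst P f - fun _ => ∫ x, f x ∂prodLaw P r) := by
    ext z; simp [influence]
  rw [h, eLpNorm_const_smul, mul_assoc, two_mul]
  have hr : ‖(r : ℝ)‖ₑ = r := by simp
  rw [hr]
  gcongr
  refine (eLpNorm_sub_le (measurable_condMeanFirst P hf).aestronglyMeasurable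
    aestronglyMeasurable_const one_le_two).trans ?_
  exact add_le_add (eLpNorm_condMeanFirst_le P hf (hi.integrable one_le_two))
    (eLpNorm_integral_le P hi)

/-- The influence function depends Lipschitz continuously on the kernel in `L²`. -/
theorem eLpNorm_influence_sub_le (P : Measure 𝒵) [IsProbabilityMeasure P]
    {f g : (Fin r → 𝒵) → ℝ} (hf : Measurable f) (hi : MemLp f 2 (prodLaw P r))
    (hg : Measurable g) (hj : MemLp g 2 (prodLaw P r)) :
    eLpNorm (influence P f - influence P g) 2 P ≤ r * 2 * eLpNorm (f - g) 2 (prodLaw P r) := by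
  refine le_of_eq_of_le (eLpNorm_congr_ae ?_) (eLpNorm_influence_le P (hf.sub hg) (hi.sub hj))
  have h1 := hi.integrable one_le_two
  have h2 := hj.integrable one_le_two
  filter_upwards [condMeanFirst_sub_ae P h1 h2] with z hz
  simp only [influence, Pi.sub_apply, hz]
  rw [integral_sub h1 h2]
  ring

/-- What is left of a kernel after subtracting its mean and its projection onto sums of functions
of single observations. -/
noncomputable def hoeffdingRemainder (P : Measure 𝒵) (f : (Fin r → 𝒵) → ℝ) (x : Fin r → 𝒵) : ℝ :=
  f x - ∫ y, f y ∂prodLaw P r - ∑ j, (condMeanFirst P f (x j) - ∫ y, f y ∂prodLaw P r)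

theorem measurable_hoeffdingRemainder (P : Measure 𝒵) [IsProbabilityMeasure P]
    {f : (Fin r → 𝒵) → ℝ} (hf : Measurable f) : Measurable (hoeffdingRemainder P f) := by
  have := measurable_condMeanFirst P hf
  unfold hoeffdingRemainder
  fun_prop

/-- The first `2` counts the kernel and its mean; each of the `r` projected summands contributes
another `2`, for the conditional mean and the mean. -/
theorem eLpNorm_hoeffdingRemainder_le (P : Measure 𝒵) [IsProbabilityMeasure P]
    {f : (Fin r → 𝒵) → ℝ} (hf : Measurable f) (hi : MemLp f 2 (prodLaw P r)) :
    eLpNorm (hoeffdingRemainder P f) 2 (prodLaw P r)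
      ≤ (2 + r * 2) * eLpNorm f 2 (prodLaw P r) := by
  have hm := measurable_condMeanFirst P hf
  have h : hoeffdingRemainder P f = (f - fun _ => ∫ y, f y ∂prodLaw P r)
      - ∑ j : Fin r, (fun z => condMeanFirst P f z - ∫ y, f y ∂prodLaw P r) ∘ fun x => x j := by
    ext x; simp [hoeffdingRemainder]
  have hj' : ∀ j : Fin r, AEStronglyMeasurable ((fun z => condMeanFirst P f z
      - ∫ y, f y ∂prodLaw P r) ∘ fun x : Fin r → 𝒵 => x j) (prodLaw P r) := fun j =>
    ((hm.sub_const _).comp (measurable_pi_apply j)).aestronglyMeasurable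
  rw [h, add_mul]
  refine (eLpNorm_sub_le (by fun_prop) ?_ one_le_two).trans (add_le_add ?_ ?_)
  · exact Finset.aestronglyMeasurable_sum _ fun j _ => hj' j
  · refine (eLpNorm_sub_le (by fun_prop) (by fun_prop) one_le_two).trans ?_
    rw [two_mul]
    exact add_le_add le_rfl (eLpNorm_integral_le _ hi)
  · refine (eLpNorm_sum_le (fun j _ => hj' j) one_le_two).trans ?_
    have hj : ∀ j : Fin r, eLpNorm ((fun z => condMeanFirst P f z - ∫ y, f y ∂prodLaw P r)
        ∘ fun x : Fin r → 𝒵 => x j) 2 (prodLaw P r) ≤ 2 * eLpNorm f 2 (prodLaw P r) := by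
      intro j
      rw [eLpNorm_comp_measurePreserving (by fun_prop) (measurePreserving_eval (fun _ => P) j)]
      refine (eLpNorm_sub_le (f := condMeanFirst P f) (by fun_prop) (by fun_prop)
        one_le_two).trans ?_
      rw [two_mul]
      exact add_le_add (eLpNorm_condMeanFirst_le P hf (hi.integrable one_le_two))
        (eLpNorm_integral_le P hi)
    refine (Finset.sum_le_sum fun j _ => hj j).trans ?_
    simp [mul_assoc]

theorem memLp_hoeffdingRemainder (P : Measure 𝒵) [IsProbabilityMeasure P]
    {f : (Fin r → 𝒵) → ℝ} (hf : Measurable f) (hi : MemLp f 2 (prodLaw P r)) :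
    MemLp (hoeffdingRemainder P f) 2 (prodLaw P r) := by
  refine ⟨(measurable_hoeffdingRemainder P hf).aestronglyMeasurable,
    (eLpNorm_hoeffdingRemainder_le P hf hi).trans_lt ?_⟩
  exact ENNReal.mul_lt_top (by finiteness) hi.2

/-- The remainder of a symmetric kernel is degenerate in each coordinate. -/
theorem integral_hoeffdingRemainder_update (P : Measure 𝒵) [IsProbabilityMeasure P]
    {f : (Fin r → 𝒵) → ℝ} (hf : Measurable f) (hi : MemLp f 2 (prodLaw P r))
    (hs : ∀ (σ : Equiv.Perm (Fin r)) x, f (x ∘ σ) = f x) (j : Fin r) :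
    ∀ᵐ z ∂P, ∫ x, hoeffdingRemainder P f (Function.update x j z) ∂prodLaw P r = 0 := by
  have hi1 := hi.integrable one_le_two
  filter_upwards [ae_integrable_update_first P hi1] with z hz
  set θ := ∫ y, f y ∂prodLaw P r with hθ
  set φ : 𝒵 → ℝ := fun z => condMeanFirst P f z - θ with hφ
  have hmp := measurePreserving_comp_embedding P (Equiv.swap (0 : Fin r) j).toEmbedding
  have hφi : Integrable φ P :=
    ((memLp_condMeanFirst P hf hi).integrable one_le_two).sub (integrable_const _)
  have hφ0 : ∫ z, φ z ∂P = 0 := by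
    rw [integral_sub ((memLp_condMeanFirst P hf hi).integrable one_le_two) (integrable_const _),
      integral_condMeanFirst P hi1]
    simp [hθ]
  -- By symmetry, freezing coordinate `j` amounts to freezing coordinate `0` of a permuted sample.
  -- The first bracket then integrates to zero by the definition of `φ`, and the remaining summands
  -- are centred.
  have hu : ∀ x, hoeffdingRemainder P f (Function.update x j z)
      = (f (Function.update (x ∘ Equiv.swap 0 j) 0 z) - θ - φ z)
        - ∑ l ∈ Finset.univ.erase j, φ (x l) := by
    intro x
    rw [hoeffdingRemainder, ← update_eq_update_first_of_symm hs, sub_sub _ (φ z)]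
    congr 1
    rw [← Finset.add_sum_erase _ _ (Finset.mem_univ j)]
    simp only [Function.update_self]
    congr 1
    refine Finset.sum_congr rfl fun l hl => ?_
    rw [Function.update_of_ne (Finset.ne_of_mem_erase hl)]
  have hfi : Integrable (fun x : Fin r → 𝒵 => f (Function.update (x ∘ Equiv.swap 0 j) 0 z))
      (prodLaw P r) := hmp.integrable_comp_of_integrable hz
  have hfe : ∫ x : Fin r → 𝒵, f (Function.update (x ∘ Equiv.swap 0 j) 0 z) ∂prodLaw P r
      = condMeanFirst P f z := hmp.integral_comp_of_aestronglyMeasurable hz.aestronglyMeasurable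
  have hl : ∀ l : Fin r, Integrable (fun x : Fin r → 𝒵 => φ (x l)) (prodLaw P r) := fun l =>
    (measurePreserving_eval (fun _ => P) l).integrable_comp_of_integrable hφi
  have hl0 : ∀ l : Fin r, ∫ x : Fin r → 𝒵, φ (x l) ∂prodLaw P r = 0 := fun l =>
    ((measurePreserving_eval (fun _ => P) l).integral_comp_of_aestronglyMeasurable
      hφi.aestronglyMeasurable).trans hφ0
  simp only [hu]
  have h1 : Integrable (fun x : Fin r → 𝒵 =>
      f (Function.update (x ∘ Equiv.swap 0 j) 0 z) - θ) (prodLaw P r) :=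
    hfi.sub (integrable_const _)
  have h2 : Integrable (fun x : Fin r → 𝒵 =>
      f (Function.update (x ∘ Equiv.swap 0 j) 0 z) - θ - φ z) (prodLaw P r) :=
    h1.sub (integrable_const _)
  rw [integral_sub h2 (integrable_finsetSum _ fun l _ => hl l), integral_sub h1
    (integrable_const _), integral_sub hfi (integrable_const _), hfe,
    integral_finsetSum _ fun l _ => hl l]
  rw [Finset.sum_eq_zero fun l _ => hl0 l]
  simp [hφ]

/-- Hoeffding decomposition of a U-statistic to first order. -/
theorem uMean_sub_integral_eq (P : Measure 𝒵) {n : ℕ} (hrn : r ≤ n)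
    (f : (Fin r → 𝒵) → ℝ) (z : Fin n → 𝒵) :
    uMean f z - ∫ x, f x ∂prodLaw P r
      = uMean (hoeffdingRemainder P f) z + (n : ℝ)⁻¹ * ∑ i, influence P f (z i) := by
  set θ := ∫ x, f x ∂prodLaw P r with hθ
  have h : uMean f z = uMean (fun x => (hoeffdingRemainder P f x
      + ∑ j, (fun w => condMeanFirst P f w - θ) (x j)) + θ) z := by
    congr 1
    ext x; simp only [hoeffdingRemainder]; ring
  rw [h, uMean_add, uMean_add, uMean_const hrn,
    uMean_sum_apply hrn fun w => condMeanFirst P f w - θ]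
  simp only [influence, ← hθ]
  ring

/-- The `L²` norm of a normalized sum of centred i.i.d. variables. -/
theorem eLpNorm_inv_sqrt_mul_sum_le (P : Measure 𝒵) [IsProbabilityMeasure P] (n : ℕ)
    {φ : 𝒵 → ℝ} (hφ : MemLp φ 2 P) (h0 : ∫ z, φ z ∂P = 0) :
    eLpNorm (fun z : Fin n → 𝒵 => (√(n : ℝ))⁻¹ * ∑ i, φ (z i)) 2 (prodLaw P n)
      ≤ eLpNorm φ 2 P := by
  have hev : ∀ i : Fin n, MeasurePreserving (fun z : Fin n → 𝒵 => z i) (prodLaw P n) P :=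
    fun i => measurePreserving_eval (fun _ => P) i
  have hX : ∀ i : Fin n, MemLp (fun z : Fin n → 𝒵 => φ (z i)) 2 (prodLaw P n) :=
    fun i => hφ.comp_measurePreserving (hev i)
  have hX0 : ∀ i : Fin n, ∫ z : Fin n → 𝒵, φ (z i) ∂prodLaw P n = 0 := fun i =>
    ((hev i).integral_comp_of_aestronglyMeasurable hφ.1).trans h0
  have hS : MemLp (fun z : Fin n → 𝒵 => ∑ i, φ (z i)) 2 (prodLaw P n) :=
    memLp_finsetSum _ fun i _ => hX i
  have hind : iIndepFun (fun (i : Fin n) (z : Fin n → 𝒵) => φ (z i)) (prodLaw P n) :=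
    iIndepFun_pi (X := fun _ => φ) fun _ => hφ.1.aemeasurable
  have hvar := IndepFun.variance_sum (s := Finset.univ) (fun i _ => hX i)
    fun i _ j _ hij => hind.indepFun hij
  have hS0 : ∫ z : Fin n → 𝒵, ∑ i, φ (z i) ∂prodLaw P n = 0 := by
    rw [integral_finsetSum _ fun i _ => (hX i).integrable one_le_two]
    simp [hX0]
  have e1 : (∑ i : Fin n, fun z : Fin n → 𝒵 => φ (z i)) = fun z => ∑ i, φ (z i) := by
    ext z; simp
  rw [e1, variance_of_integral_eq_zero hS.1.aemeasurable hS0] at hvar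
  have hvi : ∀ i : Fin n, Var[fun z : Fin n → 𝒵 => φ (z i); prodLaw P n] = ∫ z, φ z ^ 2 ∂P := by
    intro i
    rw [variance_of_integral_eq_zero (hX i).1.aemeasurable (hX0 i)]
    exact (hev i).integral_comp_of_aestronglyMeasurable (f := fun z => φ z ^ 2) (hφ.1.pow 2)
  simp only [hvi, Finset.sum_const, Finset.card_univ, Fintype.card_fin, nsmul_eq_mul] at hvar
  rw [eLpNorm_two_eq_ofReal_sqrt hφ, eLpNorm_two_eq_ofReal_sqrt (hS.const_mul _)]
  refine ENNReal.ofReal_le_ofReal (Real.sqrt_le_sqrt ?_)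
  simp only [mul_pow, inv_pow, Real.sq_sqrt (Nat.cast_nonneg n)]
  rw [integral_const_mul, hvar]
  have : 0 ≤ ∫ z, φ z ^ 2 ∂P := integral_nonneg fun _ => sq_nonneg _
  rcases eq_or_ne (n : ℝ) 0 with h | h
  · simp [h, this]
  · rw [← mul_assoc, inv_mul_cancel₀ h, one_mul]

/-- Distance of a normalized U-statistic from the linear statistic of another kernel. -/
theorem eLpNorm_uMean_sub_linear_le (P : Measure 𝒵) [IsProbabilityMeasure P] {n : ℕ} (hn : 2 ≤ n)
    (hrn : r ≤ n) {f g : (Fin r → 𝒵) → ℝ} (hf : Measurable f) (hi : MemLp f 2 (prodLaw P r))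
    (hs : ∀ (σ : Equiv.Perm (Fin r)) x, f (x ∘ σ) = f x)
    (hg : Measurable g) (hj : MemLp g 2 (prodLaw P r)) :
    eLpNorm (fun z : Fin n → 𝒵 => uFluctuation P f z
        - (√(n : ℝ))⁻¹ * ∑ i, influence P g (z i)) 2 (prodLaw P n)
      ≤ ENNReal.ofReal (r * (r - 1) / √(n - 1)) * ((2 + r * 2) * eLpNorm f 2 (prodLaw P r))
        + r * 2 * eLpNorm (f - g) 2 (prodLaw P r) := by
  have hn0 : (0 : ℝ) < n := by exact_mod_cast (by omega : 0 < n)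
  -- The error is the degenerate remainder of `f` plus a normalized sum of centred differences of
  -- influence functions; the two are bounded separately.
  have h : (fun z : Fin n → 𝒵 => uFluctuation P f z - (√(n : ℝ))⁻¹ * ∑ i, influence P g (z i))
      = (fun z => √(n : ℝ) * uMean (hoeffdingRemainder P f) z)
        + fun z => (√(n : ℝ))⁻¹ * ∑ i, (influence P f - influence P g) (z i) := by
    ext z
    have hsq : √(n : ℝ) * (n : ℝ)⁻¹ = (√(n : ℝ))⁻¹ := by
      rw [← div_eq_mul_inv, Real.sqrt_div_self']
      simp
    simp only [uFluctuation, uMean_sub_integral_eq P hrn, Pi.add_apply, Pi.sub_apply,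
      Finset.sum_sub_distrib, mul_add, mul_sub, ← mul_assoc, hsq]
    ring
  have hrem := memLp_hoeffdingRemainder P hf hi
  have hdiff := (memLp_influence P hf hi).sub (memLp_influence P hg hj)
  rw [h]
  refine (eLpNorm_add_le ((memLp_uMean P hrem).const_mul _).1 ?_ one_le_two).trans
    (add_le_add ?_ ?_)
  · have hm : Measurable (influence P f - influence P g) :=
      (measurable_influence P hf).sub (measurable_influence P hg)
    have hm' : ∀ i : Fin n, Measurable fun z : Fin n → 𝒵 =>
        (influence P f - influence P g) (z i) := fun i => hm.comp (measurable_pi_apply i)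
    exact ((Finset.measurable_fun_sum _ fun i _ => hm' i).const_mul _).aestronglyMeasurable
  · refine (eLpNorm_sqrt_mul_uMean_le P hn (measurable_hoeffdingRemainder P hf) hrem
      (integral_hoeffdingRemainder_update P hf hi hs)).trans ?_
    gcongr
    exact eLpNorm_hoeffdingRemainder_le P hf hi
  · refine (eLpNorm_inv_sqrt_mul_sum_le P n hdiff ?_).trans
      (eLpNorm_influence_sub_le P hf hi hg hj)
    simp only [Pi.sub_apply]
    rw [integral_sub ((memLp_influence P hf hi).integrable one_le_two)
      ((memLp_influence P hg hj).integrable one_le_two), integral_influence P hf hi,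
      integral_influence P hg hj, sub_zero]

end Projection

/-! ### General facts on convergence in probability and in distribution. -/

section Convergence

/-- The union bound holds for outer measure, so no measurability is asked of the summands. -/
theorem _root_.MeasureTheory.TendstoInMeasure.zero_add_zero {Ω ι : Type*} [MeasurableSpace Ω]
    {μ : Measure Ω} {l : Filter ι} {X Y : ι → Ω → ℝ} (hX : TendstoInMeasure μ X l fun _ => 0)
    (hY : TendstoInMeasure μ Y l fun _ => 0) :
    TendstoInMeasure μ (fun i ω => X i ω + Y i ω) l fun _ => 0 := by
  rw [tendstoInMeasure_iff_norm] at *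
  intro ε hε
  have h := (hX (ε / 2) (half_pos hε)).add (hY (ε / 2) (half_pos hε))
  rw [add_zero] at h
  refine tendsto_of_tendsto_of_tendsto_of_le_of_le tendsto_const_nhds h (fun _ => zero_le)
    fun i => (measure_mono fun ω hω => ?_).trans (measure_union_le _ _)
  simp only [sub_zero, Set.mem_ofPred_eq, Set.mem_union] at hω ⊢
  by_contra! hc
  linarith [norm_add_le (X i ω) (Y i ω), hc.1, hc.2]

/-- A bound in `L^q` makes a family uniformly integrable in `L^p` for `p < q`. -/
theorem unifIntegrable_of_eLpNorm_le {α ι : Type*} [MeasurableSpace α] {μ : Measure α}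
    {p q : ENNReal} (hp : 1 ≤ p) (hpq : p < q) (hq : q ≠ ⊤) {f : ι → α → ℝ}
    (hf : ∀ i, AEStronglyMeasurable (f i) μ) {C : ℝ} (hC : 0 < C)
    (h : ∀ i, eLpNorm (f i) q μ ≤ ENNReal.ofReal C) : UnifIntegrable f p μ := by
  intro ε hε
  have hpt : p ≠ ⊤ := hpq.ne_top
  have hp0 : 0 < p.toReal := ENNReal.toReal_pos (by positivity) hpt
  have hlt : p.toReal < q.toReal := (ENNReal.toReal_lt_toReal hpt hq).2 hpq
  set a := 1 / p.toReal - 1 / q.toReal with ha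
  have ha0 : 0 < a := sub_pos.2 (one_div_lt_one_div_of_lt hp0 hlt)
  -- Hölder bounds the `L^p` norm on `s` by `C μ(s)^a`; this `δ` solves `C δ^a = ε`.
  refine ⟨(ε / C) ^ a⁻¹, by positivity, fun i s hs hμs => ?_⟩
  rw [eLpNorm_indicator_eq_eLpNorm_restrict hs]
  refine (eLpNorm_le_eLpNorm_mul_rpow_measure_univ hpq.le (hf i).restrict).trans ?_
  rw [Measure.restrict_apply_univ, ← ha]
  refine (mul_le_mul' ((eLpNorm_mono_measure _ Measure.restrict_le_self).trans (h i))
    (ENNReal.rpow_le_rpow hμs ha0.le)).trans (le_of_eq ?_)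
  rw [ENNReal.ofReal_rpow_of_nonneg (by positivity) ha0.le, ← ENNReal.ofReal_mul hC.le,
    Real.rpow_inv_rpow (by positivity) ha0.ne', mul_div_cancel₀ _ hC.ne']

/-- Convergence in distribution depends on the laws alone, so a limit theorem can be moved between
probability spaces. -/
theorem _root_.MeasureTheory.TendstoInDistribution.of_map_eq {ι Ω' E : Type*} {Ω₁ Ω₂ : ι → Type*}
    [TopologicalSpace E] [MeasurableSpace E] [OpensMeasurableSpace E]
    [∀ i, MeasurableSpace (Ω₁ i)] [∀ i, MeasurableSpace (Ω₂ i)] [MeasurableSpace Ω']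
    {μ : ∀ i, Measure (Ω₁ i)} {ν : ∀ i, Measure (Ω₂ i)} {μ' : Measure Ω'}
    [∀ i, IsProbabilityMeasure (μ i)] [∀ i, IsProbabilityMeasure (ν i)] [IsProbabilityMeasure μ']
    {X : ∀ i, Ω₁ i → E} {Y : ∀ i, Ω₂ i → E} {T : Ω' → E} {l : Filter ι}
    (h : TendstoInDistribution X l T μ μ') (hY : ∀ i, AEMeasurable (Y i) (ν i))
    (he : ∀ i, (ν i).map (Y i) = (μ i).map (X i)) : TendstoInDistribution Y l T ν μ' := by
  refine ⟨hY, h.aemeasurable_limit, ?_⟩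
  have h1 := h.tendsto
  have h2 : (fun n => (⟨(ν n).map (Y n), Measure.isProbabilityMeasure_map (hY n)⟩ :
      ProbabilityMeasure E)) = fun n => ⟨(μ n).map (X n),
        Measure.isProbabilityMeasure_map (h.forall_aemeasurable n)⟩ := by
    funext n
    exact Subtype.ext (he n)
  rw [h2]
  exact h1

end Convergence

/-! ### Limit theorems for triangular arrays of samples. -/

section Sample

variable {Ω 𝒵 : Type*} [MeasurableSpace Ω] [MeasurableSpace 𝒵]

theorem aemeasurable_sample {μ : Measure Ω} {P : Measure 𝒵} {n : ℕ} {X : Fin n → Ω → 𝒵}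
    (hX : ∀ i, HasLaw (X i) P μ) : AEMeasurable (fun ω i => X i ω) μ :=
  aemeasurable_pi_lambda _ fun i => (hX i).aemeasurable

/-- The joint law of an i.i.d. sample. -/
theorem map_sample {μ : Measure Ω} [IsProbabilityMeasure μ] {P : Measure 𝒵} {n : ℕ}
    {X : Fin n → Ω → 𝒵} (hX : ∀ i, HasLaw (X i) P μ) (hind : iIndepFun X μ) :
    μ.map (fun ω i => X i ω) = prodLaw P n := by
  have h := (iIndepFun_iff_map_fun_eq_pi_map fun i => (hX i).aemeasurable).1 hind
  simp only [fun i => (hX i).map_eq] at h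
  exact h

/-- Central limit theorem for the rows of a triangular array of i.i.d. samples. -/
theorem tendstoInDistribution_sample {μ : Measure Ω} [IsProbabilityMeasure μ] {P : Measure 𝒵}
    [IsProbabilityMeasure P] {φ : 𝒵 → ℝ} (hm : Measurable φ) (hφ : MemLp φ 2 P)
    (h0 : ∫ z, φ z ∂P = 0) {Z : (n : ℕ) → Fin n → Ω → 𝒵} (hZ : ∀ n i, HasLaw (Z n i) P μ)
    (hind : ∀ n, iIndepFun (Z n) μ) :
    TendstoInDistribution (fun (n : ℕ) ω => (√(n : ℝ))⁻¹ * ∑ i, φ (Z n i ω)) atTop (id : ℝ → ℝ)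
      (fun _ => μ) (gaussianReal 0 Var[φ; P].toNNReal) := by
  -- Nothing relates different rows of `Z`, so the CLT is applied to one infinite i.i.d. sequence,
  -- whose first `n` terms have the law of row `n`.
  set Q : Measure (ℕ → 𝒵) := Measure.infinitePi fun _ => P
  have hev : ∀ i : ℕ, MeasurePreserving (fun z : ℕ → 𝒵 => z i) Q P := fun i =>
    measurePreserving_eval_infinitePi (fun _ => P) i
  have hlaw : ∀ i : ℕ, HasLaw (fun z : ℕ → 𝒵 => z i) P Q := fun i =>
    ⟨(hev i).measurable.aemeasurable, (hev i).map_eq⟩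
  have hindQ : iIndepFun (fun (i : ℕ) (z : ℕ → 𝒵) => z i) Q :=
    iIndepFun_infinitePi (X := fun _ => id) fun _ => measurable_id
  have hindφ : iIndepFun (fun (i : ℕ) (z : ℕ → 𝒵) => φ (z i)) Q :=
    iIndepFun_infinitePi (X := fun _ => φ) fun _ => hm
  have hvar : Var[fun z : ℕ → 𝒵 => φ (z 0); Q] = Var[φ; P] := by
    rw [variance_of_integral_eq_zero hm.aemeasurable h0,
      variance_of_integral_eq_zero (X := fun z : ℕ → 𝒵 => φ (z 0)) (hm.comp (hev 0).measurable).aemeasurable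
        (((hev 0).integral_comp_of_aestronglyMeasurable hφ.1).trans h0)]
    exact (hev 0).integral_comp_of_aestronglyMeasurable (f := fun z => φ z ^ 2) (hφ.1.pow 2)
  have hclt := tendstoInDistribution_inv_sqrt_mul_sum_sub (P := Q)
    (P' := gaussianReal 0 Var[φ; P].toNNReal) (Y := id)
    (X := fun (i : ℕ) (z : ℕ → 𝒵) => φ (z i))
    (by rw [hvar]; exact ⟨aemeasurable_id, Measure.map_id⟩)
    (hφ.comp_measurePreserving (hev 0)) hindφ
    (fun i => ⟨(hm.comp (hev i).measurable).aemeasurable, (hm.comp (hev 0).measurable).aemeasurable,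
      by
        rw [← Function.comp_def φ, ← Function.comp_def φ, ← Measure.map_map hm (hev i).measurable,
          ← Measure.map_map hm (hev 0).measurable, (hev i).map_eq, (hev 0).map_eq]⟩)
  have hmean : ∫ z : ℕ → 𝒵, φ (z 0) ∂Q = 0 :=
    ((hev 0).integral_comp_of_aestronglyMeasurable hφ.1).trans h0
  have hS : ∀ n : ℕ, Measurable fun z : Fin n → 𝒵 => (√(n : ℝ))⁻¹ * ∑ i, φ (z i) := by
    intro n
    fun_prop
  refine hclt.of_map_eq (fun n => (hS n).comp_aemeasurable (aemeasurable_sample (hZ n)))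
    fun n => ?_
  have e1 : μ.map (fun ω => (√(n : ℝ))⁻¹ * ∑ i, φ (Z n i ω))
      = (prodLaw P n).map fun z : Fin n → 𝒵 => (√(n : ℝ))⁻¹ * ∑ i, φ (z i) := by
    rw [← map_sample (hZ n) (hind n), AEMeasurable.map_map_of_aemeasurable (hS n).aemeasurable
      (aemeasurable_sample (hZ n))]
    rfl
  have e2 : Q.map (fun z : ℕ → 𝒵 => (√(n : ℝ))⁻¹ * ∑ i : Fin n, φ (z i))
      = (prodLaw P n).map fun z : Fin n → 𝒵 => (√(n : ℝ))⁻¹ * ∑ i, φ (z i) := by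
    have hl : ∀ i : Fin n, HasLaw (fun z : ℕ → 𝒵 => z i) P Q := fun i => hlaw i
    rw [← map_sample hl (hindQ.precomp Fin.val_injective),
      AEMeasurable.map_map_of_aemeasurable (hS n).aemeasurable (aemeasurable_sample hl)]
    rfl
  rw [e1, ← e2]
  simp only [hmean, mul_zero, sub_zero, Finset.sum_range]

/-- Normalized U-statistics with symmetric kernels converging in `L²` are asymptotically linear,
with the influence function of the limiting kernel. -/
theorem tendstoInMeasure_uFluctuation_sub_linear {μ : Measure Ω} [IsProbabilityMeasure μ]
    {P : Measure 𝒵} [IsProbabilityMeasure P] {r : ℕ} [NeZero r]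
    {Z : (n : ℕ) → Fin n → Ω → 𝒵} (hZ : ∀ n i, HasLaw (Z n i) P μ)
    (hind : ∀ n, iIndepFun (Z n) μ) {f : ℕ → (Fin r → 𝒵) → ℝ} {g : (Fin r → 𝒵) → ℝ}
    (hf : ∀ n, Measurable (f n)) (hi : ∀ n, MemLp (f n) 2 (prodLaw P r))
    (hs : ∀ n (σ : Equiv.Perm (Fin r)) x, f n (x ∘ σ) = f n x)
    (hg : Measurable g) (hj : MemLp g 2 (prodLaw P r))
    (hfg : Tendsto (fun n => eLpNorm (f n - g) 2 (prodLaw P r)) atTop (𝓝 0)) :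
    TendstoInMeasure μ (fun n ω => uFluctuation P (f n) (fun i => Z n i ω)
      - (√(n : ℝ))⁻¹ * ∑ i, influence P g (Z n i ω)) atTop fun _ => 0 := by
  have hm : ∀ n : ℕ, Measurable fun z : Fin n → 𝒵 => uFluctuation P (f n) z
      - (√(n : ℝ))⁻¹ * ∑ i, influence P g (z i) := by
    intro n
    have h1 := measurable_influence P hg
    have h2 := hf n
    unfold uFluctuation uMean
    fun_prop
  refine tendstoInMeasure_of_tendsto_eLpNorm (p := 2) (by simp)
    (fun n => ((hm n).comp_aemeasurable (aemeasurable_sample (hZ n))).aestronglyMeasurable)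
    aestronglyMeasurable_const ?_
  have hnorm : ∀ n, eLpNorm ((fun ω => uFluctuation P (f n) (fun i => Z n i ω)
      - (√(n : ℝ))⁻¹ * ∑ i, influence P g (Z n i ω)) - fun _ => (0 : ℝ)) 2 μ
      = eLpNorm (fun z : Fin n → 𝒵 => uFluctuation P (f n) z
        - (√(n : ℝ))⁻¹ * ∑ i, influence P g (z i)) 2 (prodLaw P n) := by
    intro n
    rw [← map_sample (hZ n) (hind n), eLpNorm_map_measure (hm n).aestronglyMeasurable
      (aemeasurable_sample (hZ n))]
    congr 1
    ext ω
    simp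
  simp only [hnorm]
  have hbd : ∀ n, eLpNorm (f n) 2 (prodLaw P r)
      ≤ eLpNorm (f n - g) 2 (prodLaw P r) + eLpNorm g 2 (prodLaw P r) := by
    intro n
    simpa using eLpNorm_add_le ((hi n).sub hj).1 hj.1 one_le_two
  have hc : Tendsto (fun n : ℕ => ENNReal.ofReal (r * (r - 1) / √((n : ℝ) - 1))) atTop (𝓝 0) := by
    rw [← ENNReal.ofReal_zero]
    refine (ENNReal.continuous_ofReal.tendsto 0).comp (tendsto_const_nhds.div_atTop ?_)
    exact Real.tendsto_sqrt_atTop.comp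
      (tendsto_atTop_add_const_right _ (-1) tendsto_natCast_atTop_atTop)
  have hlim : Tendsto (fun n : ℕ => ENNReal.ofReal (r * (r - 1) / √((n : ℝ) - 1))
        * ((2 + r * 2) * (eLpNorm (f n - g) 2 (prodLaw P r) + eLpNorm g 2 (prodLaw P r)))
        + r * 2 * eLpNorm (f n - g) 2 (prodLaw P r)) atTop (𝓝 0) := by
    have h1 : Tendsto (fun n => (2 + r * 2 : ENNReal)
        * (eLpNorm (f n - g) 2 (prodLaw P r) + eLpNorm g 2 (prodLaw P r))) atTop
        (𝓝 ((2 + r * 2) * (0 + eLpNorm g 2 (prodLaw P r)))) :=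
      ENNReal.Tendsto.const_mul (hfg.add tendsto_const_nhds) (Or.inr (by finiteness))
    have h2 := ENNReal.Tendsto.mul hc (Or.inr (ENNReal.mul_ne_top (by finiteness)
      (by simpa using hj.2.ne))) h1 (Or.inr ENNReal.zero_ne_top)
    have h3 : Tendsto (fun n => (r * 2 : ENNReal) * eLpNorm (f n - g) 2 (prodLaw P r)) atTop
        (𝓝 (r * 2 * 0)) := ENNReal.Tendsto.const_mul hfg (Or.inr (by finiteness))
    simpa using h2.add h3
  refine tendsto_of_tendsto_of_tendsto_of_le_of_le' tendsto_const_nhds hlim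
    (Eventually.of_forall fun _ => zero_le) ?_
  -- The second moment bound needs `n ≥ 2`, the Hoeffding decomposition `n ≥ r`.
  filter_upwards [eventually_ge_atTop (max 2 r)] with n hn
  refine (eLpNorm_uMean_sub_linear_le P ((le_max_left _ _).trans hn) ((le_max_right _ _).trans hn)
    (hf n) (hi n) (hs n) hg hj).trans ?_
  gcongr
  exact hbd n

end Sample

/-! ### Taylor expansion along a segment. -/

section Taylor

/-- Second-order Taylor expansion about a critical point. -/
theorem exists_sub_eq_half_deriv_deriv {φ : ℝ → ℝ}
    (h1 : ∀ t ∈ Set.Icc (0 : ℝ) 1, DifferentiableAt ℝ φ t)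
    (h2 : ∀ t ∈ Set.Icc (0 : ℝ) 1, DifferentiableAt ℝ (deriv φ) t) (h0 : deriv φ 0 = 0) :
    ∃ ξ ∈ Set.Icc (0 : ℝ) 1, φ 1 - φ 0 = deriv (deriv φ) ξ / 2 := by
  -- Cauchy's mean value theorem against `t²` gives `φ 1 - φ 0 = φ'(c) / (2c)`; the mean value
  -- theorem for `φ'` on `[0, c]` then gives `φ'(c) / c = φ''(ξ)`. Continuity of `φ''` is not
  -- required.
  obtain ⟨c, hc, he⟩ := exists_ratio_hasDerivAt_eq_ratio_slope φ (deriv φ) zero_lt_one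
    (fun t ht => (h1 t ht).continuousAt.continuousWithinAt)
    (fun t ht => (h1 t (Set.Ioo_subset_Icc_self ht)).hasDerivAt) (fun t => t ^ 2)
    (fun t => 2 * t) (by fun_prop) (fun t _ => by simpa using hasDerivAt_pow 2 t)
  have hsub : Set.Icc 0 c ⊆ Set.Icc (0 : ℝ) 1 := Set.Icc_subset_Icc_right hc.2.le
  obtain ⟨ξ, hξ, he2⟩ := exists_hasDerivAt_eq_slope (deriv φ) (deriv (deriv φ)) hc.1
    (fun t ht => (h2 t (hsub ht)).continuousAt.continuousWithinAt)
    (fun t ht => (h2 t (hsub (Set.Ioo_subset_Icc_self ht))).hasDerivAt)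
  refine ⟨ξ, hsub (Set.Ioo_subset_Icc_self hξ), ?_⟩
  have hc0 : c ≠ 0 := hc.1.ne'
  rw [he2, h0]
  field_simp
  linarith

/-- Along a segment starting at a critical point, a twice Gateaux differentiable functional
changes by half a second derivative at an intermediate point. -/
theorem exists_segment_sub_eq_half_gateauxDeriv₂ {B : Type*} [AddCommGroup B] [Module ℝ B]
    {T : B → ℝ} {f g : B} (h1 : HasGateauxDeriv T f (g - f) 0)
    (h2 : ∀ x ∈ segment ℝ f g, GateauxTwiceDifferentiable T x (g - f)) :
    ∃ x ∈ segment ℝ f g, T g - T f = gateauxDeriv₂ T x (g - f) / 2 := by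
  set φ : ℝ → ℝ := fun t => T (f + t • (g - f)) with hφ
  have hseg : ∀ ξ ∈ Set.Icc (0 : ℝ) 1, f + ξ • (g - f) ∈ segment ℝ f g := by
    intro ξ hξ
    rw [segment_eq_image']
    exact ⟨ξ, hξ, rfl⟩
  have hsh : ∀ ξ : ℝ, (fun t : ℝ => T (f + ξ • (g - f) + t • (g - f))) = fun t => φ (ξ + t) := by
    intro ξ
    ext t
    simp only [hφ, add_smul, add_assoc]
  have hd : ∀ ξ : ℝ, (deriv fun t => φ (ξ + t)) = fun t => deriv φ (ξ + t) := by
    intro ξ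
    ext t
    exact deriv_comp_const_add φ ξ t
  have hda : ∀ (ψ : ℝ → ℝ) (ξ : ℝ), DifferentiableAt ℝ (fun t => ψ (ξ + t)) 0 →
      DifferentiableAt ℝ ψ ξ := by
    intro ψ ξ h
    have h' : DifferentiableAt ℝ (fun t => ψ (ξ + t)) (ξ - ξ) := by rwa [sub_self]
    have h2 : DifferentiableAt ℝ (fun s : ℝ => s - ξ) ξ := by fun_prop
    simpa [Function.comp_def] using
      DifferentiableAt.comp (f := fun s : ℝ => s - ξ) (g := fun t => ψ (ξ + t)) ξ h' h2
  obtain ⟨ξ, hξ, he⟩ := exists_sub_eq_half_deriv_deriv (φ := φ)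
    (fun t ht => by
      have h := (h2 _ (hseg t ht)).1.self_of_nhds
      rw [hsh] at h
      exact hda φ t h)
    (fun t ht => by
      have h := (h2 _ (hseg t ht)).2
      rw [hsh, hd] at h
      exact hda (deriv φ) t h)
    h1.deriv
  refine ⟨f + ξ • (g - f), hseg ξ hξ, ?_⟩
  rw [gateauxDeriv₂, hsh, hd, deriv_comp_const_add, add_zero, ← he]
  simp [hφ]

end Taylor

end SmoothUStat

/-! ### Assembly of the main theorem. -/

open SmoothUStat in
theorem mainTheorem3
    {Ω 𝒵 𝒲 : Type*} [MeasurableSpace Ω] [MeasurableSpace 𝒵] [MeasurableSpace 𝒲]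
    (μ : Measure Ω) [IsProbabilityMeasure μ]
    (P : Measure 𝒵) [IsProbabilityMeasure P]
    -- the component `W = w(Z)` of an observation, with law `P.map w`
    (w : 𝒵 → 𝒲) (hw : Measurable w)
    (k r : ℕ) [NeZero r]
    -- the scores `m^β` and their true nuisances `g_β`
    (m : ℝ → (Fin r → 𝒵) → Nuisance 𝒲 k → ℝ)
    (hsymm : ∀ β : ℝ, 0 < β → ∀ (g : Nuisance 𝒲 k) (σ : Equiv.Perm (Fin r)) (z : Fin r → 𝒵),
      m β (z ∘ σ) g = m β z g)
    (gtrue : ℝ → Nuisance 𝒲 k)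
    (hgtrue : ∀ β : ℝ, 0 < β → MemLp (gtrue β) 2 (P.map w))
    (hm_meas : ∀ β : ℝ, 0 < β → Measurable fun z => m β z (gtrue β))
    -- the limiting score `m^*` and limiting nuisance `g_0`
    (mstar : (Fin r → 𝒵) → Nuisance 𝒲 k → ℝ) (g₀ : Nuisance 𝒲 k)
    (hg₀ : MemLp g₀ 2 (P.map w))
    (hmstar_meas : Measurable fun z => mstar z g₀)
    -- for each `n`, an i.i.d. sample `Z n 0, …, Z n (n - 1)` from `P`
    (Z : (n : ℕ) → Fin n → Ω → 𝒵)
    (hZ_law : ∀ n i, HasLaw (Z n i) P μ)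
    (hZ_indep : ∀ n, iIndepFun (Z n) μ)
    -- the smoothing parameters
    (β : ℕ → ℝ) (hβ_pos : ∀ n, 0 < β n) (hβ : Tendsto β atTop atTop)
    -- the nuisance estimates, independent of the sample
    (ghat : ℕ → Ω → Nuisance 𝒲 k)
    (hghat_meas : ∀ n, Measurable (ghat n))
    (hghat : ∀ n, ∀ᵐ ω ∂μ, MemLp (ghat n ω) 2 (P.map w))
    (hghat_indep : ∀ n, IndepFun (ghat n) (fun ω i => Z n i ω) μ)
    (hmhat_meas : ∀ n, Measurable fun p : Ω × (Fin r → 𝒵) => m (β n) p.2 (ghat n p.1))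
    -- Neyman orthogonality
    (h_neyman : ∀ b : ℝ, 0 < b → ∀ n, ∀ᵐ ω ∂μ,
      HasGateauxDeriv (popMean P (m b)) (gtrue b) (ghat n ω - gtrue b) 0)
    -- second-order Gateaux derivatives along the segment `[g_{β_n}, ĝ_n]`
    (h_exists₂ : ∀ n, ∀ᵐ ω ∂μ, ∀ gbar ∈ segment ℝ (gtrue (β n)) (ghat n ω),
      GateauxTwiceDifferentiable (popMean P (m (β n))) gbar (ghat n ω - gtrue (β n)))
    (h_second : ∀ gbar : ℕ → Ω → Nuisance 𝒲 k,
      (∀ n ω, gbar n ω ∈ segment ℝ (gtrue (β n)) (ghat n ω)) →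
      IsLittleOP μ
        (fun n ω => gateauxDeriv₂ (popMean P (m (β n))) (gbar n ω) (ghat n ω - gtrue (β n)))
        (fun n => (n : ℝ) ^ (-(1 / 2) : ℝ)))
    -- convergence of the score in probability, as `β → ∞`
    (h_score : TendstoInMeasure (prodLaw P r) (fun b z => m b z (gtrue b)) atTop
      (fun z => mstar z g₀))
    -- stochastic equicontinuity
    (h_equi : IsLittleOP μ
      (fun n ω => |uFluctuation P (fun z => m (β n) z (ghat n ω)) (fun i => Z n i ω)
        - uFluctuation P (fun z => m (β n) z (gtrue (β n))) (fun i => Z n i ω)|)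
      (fun _ => 1))
    -- uniform `L^{2+ε}` bounds
    (D ε : ℝ) (hD : 0 < D) (hε : 0 < ε)
    (h_reg : ∀ b : ℝ, 0 < b →
      eLpNorm (fun z => m b z (gtrue b)) (ENNReal.ofReal (2 + ε)) (prodLaw P r)
        ≤ ENNReal.ofReal D)
    (h_reg_star : eLpNorm (fun z => mstar z g₀) (ENNReal.ofReal (2 + ε)) (prodLaw P r)
        ≤ ENNReal.ofReal D) :
    -- asymptotic linearity
    IsLittleOP μ
      (fun n ω =>
        √(n : ℝ) * (uMean (fun z => m (β n) z (ghat n ω)) (fun i => Z n i ω)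
            - popMean P (m (β n)) (gtrue (β n)))
          - (√(n : ℝ))⁻¹ * ∑ i, influence P (fun z => mstar z g₀) (Z n i ω))
      (fun _ => 1) ∧
    -- asymptotic normality
    (0 < Var[influence P (fun z => mstar z g₀); P] →
      TendstoInDistribution
        (fun (n : ℕ) ω =>
          √(n : ℝ) * (uMean (fun z => m (β n) z (ghat n ω)) (fun i => Z n i ω)
            - popMean P (m (β n)) (gtrue (β n))))
        atTop (id : ℝ → ℝ) (fun _ => μ)
        (gaussianReal 0 Var[influence P (fun z => mstar z g₀); P].toNNReal)) := by
  have h2ε : (2 : ENNReal) < ENNReal.ofReal (2 + ε) := by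
    rw [← ENNReal.ofReal_ofNat 2]
    exact (ENNReal.ofReal_lt_ofReal_iff (by linarith)).2 (by linarith)
  have hstar : MemLp (fun z => mstar z g₀) 2 (prodLaw P r) :=
    MemLp.mono_exponent ⟨hmstar_meas.aestronglyMeasurable,
      h_reg_star.trans_lt ENNReal.ofReal_lt_top⟩ h2ε.le
  have hmem : ∀ n, MemLp (fun z => m (β n) z (gtrue (β n))) 2 (prodLaw P r) := fun n =>
    MemLp.mono_exponent ⟨(hm_meas _ (hβ_pos n)).aestronglyMeasurable,
      (h_reg _ (hβ_pos n)).trans_lt ENNReal.ofReal_lt_top⟩ h2ε.le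
  -- Vitali's theorem: the `L^{2+ε}` bound makes the squares uniformly integrable.
  have hL2 : Tendsto (fun n => eLpNorm ((fun z => m (β n) z (gtrue (β n)))
      - fun z => mstar z g₀) 2 (prodLaw P r)) atTop (𝓝 0) :=
    tendsto_Lp_finite_of_tendstoInMeasure one_le_two (by simp) (fun n => (hmem n).1) hstar
      (unifIntegrable_of_eLpNorm_le one_le_two h2ε ENNReal.ofReal_ne_top (fun n => (hmem n).1) hD
        fun n => h_reg _ (hβ_pos n))
      (h_score.comp hβ)
  have hproj := tendstoInMeasure_uFluctuation_sub_linear hZ_law hZ_indep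
    (f := fun n z => m (β n) z (gtrue (β n))) (fun n => hm_meas _ (hβ_pos n)) hmem
    (fun n σ x => hsymm _ (hβ_pos n) _ σ x) hmstar_meas hstar hL2
  have hequi : TendstoInMeasure μ
      (fun n ω => uFluctuation P (fun z => m (β n) z (ghat n ω)) (fun i => Z n i ω)
        - uFluctuation P (fun z => m (β n) z (gtrue (β n))) (fun i => Z n i ω)) atTop
      fun _ => 0 := by
    rw [IsLittleOP, tendstoInMeasure_iff_norm] at h_equi
    rw [tendstoInMeasure_iff_norm]
    simpa using h_equi
  have hbias : TendstoInMeasure μ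
      (fun (n : ℕ) ω => √(n : ℝ) * (popMean P (m (β n)) (ghat n ω)
        - popMean P (m (β n)) (gtrue (β n)))) atTop fun _ => 0 := by
    -- `h_second` wants a point of the segment for every `ω`, whereas the expansion holds only
    -- almost surely. Hence the implication inside the existential: where differentiability fails,
    -- the left endpoint serves. The selection need not be measurable.
    have hex : ∀ n ω, ∃ x ∈ segment ℝ (gtrue (β n)) (ghat n ω),
        (HasGateauxDeriv (popMean P (m (β n))) (gtrue (β n)) (ghat n ω - gtrue (β n)) 0 ∧
          ∀ gbar ∈ segment ℝ (gtrue (β n)) (ghat n ω),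
            GateauxTwiceDifferentiable (popMean P (m (β n))) gbar (ghat n ω - gtrue (β n))) →
        popMean P (m (β n)) (ghat n ω) - popMean P (m (β n)) (gtrue (β n))
          = gateauxDeriv₂ (popMean P (m (β n))) x (ghat n ω - gtrue (β n)) / 2 := by
      intro n ω
      by_cases h : HasGateauxDeriv (popMean P (m (β n))) (gtrue (β n)) (ghat n ω - gtrue (β n)) 0 ∧
          ∀ gbar ∈ segment ℝ (gtrue (β n)) (ghat n ω),
            GateauxTwiceDifferentiable (popMean P (m (β n))) gbar (ghat n ω - gtrue (β n))
      · obtain ⟨x, hx, he⟩ := exists_segment_sub_eq_half_gateauxDeriv₂ h.1 h.2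
        exact ⟨x, hx, fun _ => he⟩
      · exact ⟨_, left_mem_segment ℝ _ _, fun h' => absurd h' h⟩
    choose gbar hgbar heq using hex
    have hsec := h_second gbar hgbar
    have hhalf : TendstoInMeasure μ (fun n ω => gateauxDeriv₂ (popMean P (m (β n))) (gbar n ω)
        (ghat n ω - gtrue (β n)) / (n : ℝ) ^ (-(1 / 2) : ℝ) / 2) atTop fun _ => 0 := by
      rw [IsLittleOP, tendstoInMeasure_iff_norm] at hsec
      rw [tendstoInMeasure_iff_norm]
      intro δ hδ
      refine (hsec (2 * δ) (by positivity)).congr fun n => ?_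
      congr 1
      ext ω
      simp only [sub_zero, Set.mem_ofPred_eq, norm_div, Real.norm_ofNat]
      rw [le_div_iff₀ (two_pos : (0 : ℝ) < 2), mul_comm]
    refine hhalf.congr_left fun n => ?_
    filter_upwards [h_neyman _ (hβ_pos n) n, h_exists₂ n] with ω h1 h2
    rw [heq n ω ⟨h1, h2⟩, Real.rpow_neg (Nat.cast_nonneg n), ← Real.sqrt_eq_rpow, div_inv_eq_mul]
    ring
  have hlin : TendstoInMeasure μ (fun (n : ℕ) ω =>
      √(n : ℝ) * (uMean (fun z => m (β n) z (ghat n ω)) (fun i => Z n i ω)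
          - popMean P (m (β n)) (gtrue (β n)))
        - (√(n : ℝ))⁻¹ * ∑ i, influence P (fun z => mstar z g₀) (Z n i ω)) atTop fun _ => 0 := by
    -- The three-term splitting is an identity: the population means at `ĝ` and at the fluctuation's
    -- centre cancel.
    refine ((hequi.zero_add_zero hbias).zero_add_zero hproj).congr_left fun n =>
      Eventually.of_forall fun ω => ?_
    simp only [uFluctuation, popMean]
    ring
  refine ⟨by simpa only [IsLittleOP, div_one] using hlin, fun _ => ?_⟩
  refine tendstoInDistribution_of_tendstoInMeasure_sub _ _
    (tendstoInDistribution_sample (measurable_influence P hmstar_meas)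
      (memLp_influence P hmstar_meas hstar) (integral_influence P hmstar_meas hstar) hZ_law
      hZ_indep) hlin fun n => ?_
  -- Slutsky's lemma needs the estimator to be a.e. measurable; this follows from joint
  -- measurability of the score in `ω` and the observations.
  have hU : Measurable fun p : Ω × (Fin n → 𝒵) => uMean (fun z => m (β n) z (ghat n p.1)) p.2 := by
    unfold uMean
    refine (Finset.measurable_fun_sum _ fun s _ => ?_).const_mul _
    exact (hmhat_meas n).comp (measurable_fst.prodMk (measurable_pi_lambda _ fun j =>
      (measurable_pi_apply _).comp measurable_snd))
  exact ((hU.comp_aemeasurable (aemeasurable_id.prodMk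
    (aemeasurable_sample (hZ_law n)))).sub_const _).const_mul _
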